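/- Let $M$ be a smooth $n$-dimensional manifold with Riemannian metric $g$, Levi-Civita connection $\hat\nabla$ and Riemannian scalar curvature $\hat\rho$. A *statistical structure* on $M$ is a pair $(g,\nabla)$, where $\nabla$ is a torsion-free affine connection such that the cubic form $\nabla g$ is symmetric. Put $K(X,Y)=\nabla_XY-\hat\nabla_XY$, $A(X,Y,Z)=g(K(X,Y),Z)$ and $E=\operatorname{tr}_gK$. For a connection with curvature tensor $R$, its Ricci tensor is $\mathrm{Ric}(Y,Z)=\operatorname{tr}\{X\mapsto R(X,Y)Z\}$, and $\rho=\operatorname{tr}_g\mathrm{Ric}$ is the scalar curvature of $\nabla$. All statements hold at every point of $M$. 1. For every statistical structure $(g,\nabla)$ on $M$, $$\hat\rho-\rho=\|A\|^2-\|E\|^2\ \ge\ -\frac{n-1}{3}\|A\|^2,\qquad \hat\rho-\rho=\|A\|^2-\|E\|^2\ \ge\ -\frac{n-1}{n+2}\|E\|^2 .$$ 2. Let $M$, with the induced metric $g$, be an (immersed) Lagrangian submanifold of a complex space form $\tilde M(4c)$, that is, of a Kähler manifold of complex dimension $n$ and of constant holomorphic sectional curvature $4c$; denote by $J$ the complex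 structure, by $\sigma$ the second fundamental tensor and by $\mu=\frac1n\operatorname{tr}_g\sigma$ the mean curvature vector. For the induced statistical structure $(g,K)$, given by $K=J\sigma$, and $A(X,Y,Z)=g(K(X,Y),Z)$, $$\hat\rho\le\frac{n(n-1)}{n+2}\bigl(c(n+2)+n\|\mu\|^2\bigr),\qquad \hat\rho\le\frac{n-1}{3}\bigl(3cn+\|A\|^2\bigr).$$ 3. Let $f:M\to\mathbb R^{n+1}$ be a locally strongly convex immersed hypersurface with equiaffine transversal vector field $\xi$; let $\nabla$ be the induced connection, $g$ (positive definite) the second fundamental form and $S$ the shape operator, so that $D_Xf_*Y=f_*(\nabla_XY)+g(X,Y)\xi$ and $D_X\xi=-f_*(SX)$, where $D$ is the standard flat connection of $\mathbb R^{n+1}$. If it is an equiaffine sphere, that is, $S=H\,\mathrm{id}$, then the curvature tensor of $\nabla$ is $R=HR_0$, where $R_0(X,Y)Z=g(Y,Z)X-g(X,Z)Y$, and $$\hat\rho\ge\frac{n-1}{n+2}\bigl(Hn(n+2)-\|E\|^2\bigr),\qquad \hat\rho\ge\frac{n-1}{3}\bigl(3Hn-\|A\|^2\bigr).$$ -/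

import Mathlib

open Bundle FiberBundle
open scoped Manifold ContDiff

noncomputable section

namespace StatGeom

section Connection

variable {E : Type*} [NormedAddCommGroup E] [NormedSpace ℝ E] [FiniteDimensional ℝ E]
  {H : Type*} [TopologicalSpace H] {I : ModelWithCorners ℝ E H}
  {M : Type*} [TopologicalSpace M] [ChartedSpace H M] [IsManifold I ∞ M]

/-- An affine connection on `M`, with Mathlib's argument order:
`cov Y x v` is `(∇_v Y)(x)`. -/
abbrev AffineConnection (I : ModelWithCorners ℝ E H) (M : Type*) [TopologicalSpace M]
    [ChartedSpace H M] [IsManifold I ∞ M] :=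
  CovariantDerivative I E (TangentSpace I : M → Type _)

instance instFiniteDimensionalTangentSpace (x : M) : FiniteDimensional ℝ (TangentSpace I x) :=
  inferInstanceAs (FiniteDimensional ℝ E)

/-- The curvature tensor `R(u, v) w = ∇_U ∇_V W - ∇_V ∇_U W - ∇_{[U, V]} W` at `x`, where
`U, V, W` are the vector fields that extend the vectors `u, v, w` with constant coefficients in the
chart at `x`. They are smooth near `x`; for a smooth connection the result does not depend on
the choice of smooth extensions. -/
def curvature (cov : AffineConnection I M) (x : M) (u v w : TangentSpace I x) :
    TangentSpace I x :=
  cov (fun y => cov (extend E w) y (extend E v y)) x u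
    - cov (fun y => cov (extend E w) y (extend E u y)) x v
    - cov (extend E w) x (VectorField.mlieBracket I (extend E u) (extend E v) x)

/-- The difference tensor `K(X, Y) = ∇_X Y - ∇'_X Y` of two connections;
Mathlib's `cov.difference cov' x` takes `Y` as its first argument and `X` as its second. -/
def differenceTensor (cov cov' : AffineConnection I M) (x : M)
    (u v : TangentSpace I x) : TangentSpace I x :=
  cov.difference cov' x v u

variable [RiemannianBundle (fun x : M => TangentSpace I x)]

/-- The Ricci tensor `Ric(v, w) = tr {u ↦ R(u, v) w}`; the trace is computed in an orthonormal
basis of the tangent space. -/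
def ricci (cov : AffineConnection I M) (x : M) (v w : TangentSpace I x) : ℝ :=
  ∑ i, inner ℝ (curvature cov x (stdOrthonormalBasis ℝ (TangentSpace I x) i) v w)
    (stdOrthonormalBasis ℝ (TangentSpace I x) i)

/-- The scalar curvature `tr_g Ric` of a connection relative to the metric. -/
def scalarCurvature (cov : AffineConnection I M) (x : M) : ℝ :=
  ∑ i, ricci cov x (stdOrthonormalBasis ℝ (TangentSpace I x) i)
    (stdOrthonormalBasis ℝ (TangentSpace I x) i)

/-- The tensor `R₀(u, v) w = g(v, w) u - g(u, w) v`. -/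
def R0 (x : M) (u v w : TangentSpace I x) : TangentSpace I x :=
  (inner ℝ v w : ℝ) • u - (inner ℝ u w : ℝ) • v

/-- The cubic form `A(u, v, w) = g(K(u, v), w)` of a tensor field `K` of type `(1, 2)`. -/
def cubicForm (K : ∀ x : M, TangentSpace I x → TangentSpace I x → TangentSpace I x)
    (x : M) (u v w : TangentSpace I x) : ℝ :=
  inner ℝ (K x u v) w

/-- `‖A‖²` for the cubic form `A` of `K`: the sum of the squares of its components in an
orthonormal basis. -/
def cubicNormSq (K : ∀ x : M, TangentSpace I x → TangentSpace I x → TangentSpace I x)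
    (x : M) : ℝ :=
  ∑ i, ∑ j, ∑ k, (cubicForm K x (stdOrthonormalBasis ℝ (TangentSpace I x) i)
    (stdOrthonormalBasis ℝ (TangentSpace I x) j)
    (stdOrthonormalBasis ℝ (TangentSpace I x) k)) ^ 2

/-- The vector field `E = tr_g K`. -/
def traceField (K : ∀ x : M, TangentSpace I x → TangentSpace I x → TangentSpace I x)
    (x : M) : TangentSpace I x :=
  ∑ i, K x (stdOrthonormalBasis ℝ (TangentSpace I x) i)
    (stdOrthonormalBasis ℝ (TangentSpace I x) i)

/-- The covariant derivative of the metric,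
`(∇_u g)(Y, Z) = u g(Y, Z) - g(∇_u Y, Z) - g(Y, ∇_u Z)` at `x`, for vector fields `Y`, `Z`. -/
def metricDeriv (cov : AffineConnection I M) (x : M) (u : TangentSpace I x)
    (Y Z : ∀ y : M, TangentSpace I y) : ℝ :=
  mvfderiv I (fun y => (inner ℝ (Y y) (Z y) : ℝ)) x u
    - inner ℝ (cov Y x u) (Z x) - inner ℝ (Y x) (cov Z x u)

/-- `cov` is the Levi-Civita connection of the metric: the smooth torsion-free connection
with `∇g = 0`. -/
structure IsLeviCivita (cov : AffineConnection I M) : Prop where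
  smooth : cov.ContMDiffCovariantDerivative ∞
  torsion_free : cov.torsion = 0
  metric : ∀ (x : M) (u : TangentSpace I x) (Y Z : ∀ y : M, TangentSpace I y),
    MDifferentiableAt I I.tangent (fun y => (TotalSpace.mk' E y (Y y) : TangentBundle I M)) x →
    MDifferentiableAt I I.tangent (fun y => (TotalSpace.mk' E y (Z y) : TangentBundle I M)) x →
    metricDeriv cov x u Y Z = 0

/-- `(g, ∇)` is a statistical structure: `∇` is a smooth torsion-free connection and the cubic
form `(∇_X g)(Y, Z)` is symmetric in `X, Y, Z`. -/
structure IsStatistical (cov : AffineConnection I M) : Prop where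
  smooth : cov.ContMDiffCovariantDerivative ∞
  torsion_free : cov.torsion = 0
  cubic_symm : ∀ (x : M) (X Y Z : ∀ y : M, TangentSpace I y),
    MDifferentiableAt I I.tangent (fun y => (TotalSpace.mk' E y (X y) : TangentBundle I M)) x →
    MDifferentiableAt I I.tangent (fun y => (TotalSpace.mk' E y (Y y) : TangentBundle I M)) x →
    MDifferentiableAt I I.tangent (fun y => (TotalSpace.mk' E y (Z y) : TangentBundle I M)) x →
    metricDeriv cov x (X x) Y Z = metricDeriv cov x (Y x) X Z ∧
    metricDeriv cov x (X x) Y Z = metricDeriv cov x (X x) Z Y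

/-- `f : M → F` is an immersed hypersurface of the affine space `F` (of dimension `dim M + 1`)
with equiaffine transversal field `ξ`, induced connection `∇`, the metric of `M` as second
fundamental form, and shape operator `S`. With `D` the flat connection of `F`, the last two fields
are the formulas of Gauss and Weingarten,
`D_X f_* Y = f_* (∇_X Y) + g(X, Y) ξ` and `D_X ξ = - f_* (S X)`. -/
structure IsEquiaffineHypersurface {F : Type*} [NormedAddCommGroup F] [NormedSpace ℝ F]
    (f ξ : M → F) (cov : AffineConnection I M)
    (S : ∀ x : M, TangentSpace I x →L[ℝ] TangentSpace I x) : Prop where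
  codim_one : Module.finrank ℝ F = Module.finrank ℝ E + 1
  smooth : cov.ContMDiffCovariantDerivative ∞
  smooth_f : ContMDiff I 𝓘(ℝ, F) ∞ f
  smooth_xi : ContMDiff I 𝓘(ℝ, F) ∞ ξ
  immersion : ∀ x : M, Function.Injective (mvfderiv I f x)
  transversal : ∀ x : M, ξ x ∉ Set.range (mvfderiv I f x)
  gauss : ∀ (x : M) (u : TangentSpace I x) (Y : ∀ y : M, TangentSpace I y),
    MDifferentiableAt I I.tangent (fun y => (TotalSpace.mk' E y (Y y) : TangentBundle I M)) x →
    mvfderiv I (fun y => mvfderiv I f y (Y y)) x u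
      = mvfderiv I f x (cov Y x u) + (inner ℝ u (Y x) : ℝ) • ξ x
  weingarten : ∀ (x : M) (u : TangentSpace I x), mvfderiv I ξ x u = - mvfderiv I f x (S x u)

/-- `(g, J)` is a Kähler structure, `cov` being the Levi-Civita connection of `g`: `J` is a smooth
almost complex structure, `g` is Hermitian, and `J` is parallel. -/
structure IsKahler (cov : AffineConnection I M)
    (J : ∀ x : M, TangentSpace I x →L[ℝ] TangentSpace I x) : Prop where
  leviCivita : IsLeviCivita cov
  smooth_J : ContMDiff I (I.prod 𝓘(ℝ, E →L[ℝ] E)) ∞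
    (fun x => TotalSpace.mk' (E →L[ℝ] E)
      (E := fun x : M => TangentSpace I x →L[ℝ] TangentSpace I x) x (J x))
  J_sq : ∀ (x : M) (u : TangentSpace I x), J x (J x u) = -u
  hermitian : ∀ (x : M) (u v : TangentSpace I x),
    (inner ℝ (J x u) (J x v) : ℝ) = inner ℝ u v
  parallel : ∀ (x : M) (u : TangentSpace I x) (Y : ∀ y : M, TangentSpace I y),
    MDifferentiableAt I I.tangent (fun y => (TotalSpace.mk' E y (Y y) : TangentBundle I M)) x →
    cov (fun y => J y (Y y)) x u = J x (cov Y x u)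

/-- `(g, J)` is a complex space form of holomorphic sectional curvature `κ`: a Kähler structure
for which every plane spanned by `u` and `J u`, `u` a unit vector, has sectional curvature
`g(R(u, J u) J u, u) = κ`. -/
structure IsComplexSpaceForm (cov : AffineConnection I M)
    (J : ∀ x : M, TangentSpace I x →L[ℝ] TangentSpace I x) (κ : ℝ) : Prop where
  kahler : IsKahler cov J
  holomorphic_curvature : ∀ (x : M) (u : TangentSpace I x), ‖u‖ = 1 →
    (inner ℝ (curvature cov x u (J x u) (J x u)) u : ℝ) = κ

end Connection

section Submanifold

variable {E : Type*} [NormedAddCommGroup E] [NormedSpace ℝ E] [FiniteDimensional ℝ E]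
  {H : Type*} [TopologicalSpace H] {I : ModelWithCorners ℝ E H}
  {M : Type*} [TopologicalSpace M] [ChartedSpace H M] [IsManifold I ∞ M]
  {E' : Type*} [NormedAddCommGroup E'] [NormedSpace ℝ E'] [FiniteDimensional ℝ E']
  {H' : Type*} [TopologicalSpace H'] {I' : ModelWithCorners ℝ E' H'}
  {N : Type*} [TopologicalSpace N] [ChartedSpace H' N] [IsManifold I' ∞ N]

variable (I) in
/-- The covariant derivative `(∇_u V)(x)` along `f : M → N` of a vector field `V` along `f`.
If `V = ∑ vᵢ (eᵢ ∘ f)` near `x`, where `eᵢ` is the coordinate frame of the chart of `N` at `f x`,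
this is `∑ (d vᵢ(u) eᵢ + vᵢ(x) ∇_{f_* u} eᵢ)`: the first term below differentiates the coefficients
of `V`, and `extend E' (V x)` is the field `∑ vᵢ(x) eᵢ`. -/
def covAlong (cov : AffineConnection I' N) (f : M → N)
    (V : ∀ x : M, TangentSpace I' (f x)) (x : M) (u : TangentSpace I x) :
    TangentSpace I' (f x) :=
  (trivializationAt E' (TangentSpace I' : N → Type _) (f x)).symm (f x)
      (mvfderiv I (fun y => (trivializationAt E' (TangentSpace I' : N → Type _) (f x)
        ⟨f y, V y⟩).2) x u)
    + cov (extend E' (V x)) (f x) (mfderiv I I' f x u)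

variable [RiemannianBundle (fun y : N => TangentSpace I' y)]

variable (I) in
/-- The second fundamental tensor `σ(u, v)` of an immersion `f`: the component normal to `f` of
`∇_u (f_* V)`, where the vector field `V` extends `v`. -/
def secondFundamentalForm (cov : AffineConnection I' N) (f : M → N) (x : M)
    (u v : TangentSpace I x) : TangentSpace I' (f x) :=
  (Submodule.orthogonal (LinearMap.range (mfderiv I I' f x).toLinearMap)).starProjection
    (covAlong I cov f (fun y => mfderiv I I' f y (extend E v y)) x u)

/-- `K` is the tensor field `J σ` on `M`, that is, `f_* (K(u, v)) = J σ(u, v)`. -/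
def IsInducedTensor (cov : AffineConnection I' N)
    (J : ∀ y : N, TangentSpace I' y →L[ℝ] TangentSpace I' y) (f : M → N)
    (K : ∀ x : M, TangentSpace I x → TangentSpace I x → TangentSpace I x) : Prop :=
  ∀ (x : M) (u v : TangentSpace I x),
    mfderiv I I' f x (K x u v) = J (f x) (secondFundamentalForm I cov f x u v)

variable [RiemannianBundle (fun x : M => TangentSpace I x)]

variable (I) in
/-- The mean curvature vector `μ = (1/n) tr_g σ`, `n = dim M`. -/
def meanCurvature (cov : AffineConnection I' N) (f : M → N) (x : M) : TangentSpace I' (f x) :=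
  (Module.finrank ℝ E : ℝ)⁻¹ • ∑ i, secondFundamentalForm I cov f x
    (stdOrthonormalBasis ℝ (TangentSpace I x) i) (stdOrthonormalBasis ℝ (TangentSpace I x) i)

/-- `f : M → N` is a Lagrangian immersion that induces the metric of `M`:
`2 dim M = dim N` (both over `ℝ`) and `J (f_* TM)` is orthogonal to `f_* TM`. -/
structure IsLagrangianImmersion (f : M → N)
    (J : ∀ y : N, TangentSpace I' y →L[ℝ] TangentSpace I' y) : Prop where
  half_dim : Module.finrank ℝ E' = 2 * Module.finrank ℝ E
  smooth : ContMDiff I I' ∞ f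
  immersion : ∀ x : M, Function.Injective (mfderiv I I' f x)
  isometric : ∀ (x : M) (u v : TangentSpace I x),
    (inner ℝ (mfderiv I I' f x u) (mfderiv I I' f x v) : ℝ) = inner ℝ u v
  lagrangian : ∀ (x : M) (u v : TangentSpace I x),
    (inner ℝ (J (f x) (mfderiv I I' f x u)) (mfderiv I I' f x v) : ℝ) = 0

end Submanifold

end StatGeom

end

set_option linter.unusedSectionVars false
set_option synthInstance.maxHeartbeats 200000

noncomputable section

open Set Filter Topology

/-! Write $a=\|A\|^2$ and $e=\|E\|^2$. Everything rests on one identity and one inequality.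

The identity is $\hat\rho-\rho=a-e$. In a chart let $\Gamma'$, $\Gamma$ be the Christoffel symbols
of $\nabla$, $\hat\nabla$ and put $D=\Gamma'-\Gamma$, which represents $K$. Symmetry of $\nabla g$
in its first two slots, together with $\hat\nabla g=0$, makes $g(D(u,v),w)$ totally symmetric. Then
$g(R'(u,v)v,u)-g(R(u,v)v,u)$ equals $g(D(u,u),D(v,v))-|D(u,v)|^2$ plus $F(u,v)-F(v,u)$, where $F$
collects all the terms with derivatives of the cubic form
(`IsCoordLeviCivita.metric_coordCurvature_sub`). Summing $u,v$ over the same orthonormal basis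
cancels $F$. `scalarCurvature_sub_of_coord_symm` states the result under coordinate symmetries only,
so that it serves both statistical structures and hypersurfaces.

The inequality is $3e\le(n+2)a$ for a totally symmetric cubic form (`three_mul_sum_trace_sq_le`):
the trace-free part of the form has nonnegative square norm. Solved for $e$ or for $a$, it gives the
two bounds of each statement.

In the Lagrangian case, differentiating $g(Jf_*v,f_*w)=0$ with $\nabla J=0$ shows that the cubic
form of $K=J\sigma$ is symmetric (`inner_J_secondFundamentalForm`). The trace of the Gauss equation
(`inner_curvature_eq`) gives $\hat\rho=cn(n-1)+e-a$, because polarization of the holomorphic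
sectional curvature $4c$ yields sectional curvature $c$ on totally real planes
(`four_mul_sectional_eq`).

In the hypersurface case, commuting second derivatives of $f$ make $\nabla$ torsion-free. Commuting
third derivatives split into the Gauss equation, whence $R=HR_0$ and $\rho=Hn(n-1)$, and the Codazzi
equation, which is the symmetry of $\nabla g$ (`hypersurface_structure`). The identity above then
applies. -/

namespace StatGeom

/-! ### Coordinate frames and coefficients in a chart -/

section Frame

variable {E : Type*} [NormedAddCommGroup E] [NormedSpace ℝ E]
  {H : Type*} [TopologicalSpace H] {I : ModelWithCorners ℝ E H}
  {M : Type*} [TopologicalSpace M] [ChartedSpace H M] [IsManifold I ∞ M]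

/-- The vector field with constant coefficients `w` in the chart at `x₀`. -/
def frame (x₀ : M) (w : E) (y : M) : TangentSpace I y :=
  (trivializationAt E (TangentSpace I : M → Type _) x₀).symm y w

/-- The coefficients of a tangent vector at `y` in the chart at `x₀`. -/
def coord (I : ModelWithCorners ℝ E H) [IsManifold I ∞ M] (x₀ y : M) : TangentSpace I y →L[ℝ] E :=
  (trivializationAt E (TangentSpace I : M → Type _) x₀).continuousLinearMapAt ℝ y

/-- The tangent vector at `y` with given coefficients in the chart at `x₀`. -/
def frameL (I : ModelWithCorners ℝ E H) [IsManifold I ∞ M] (x₀ y : M) : E →L[ℝ] TangentSpace I y :=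
  (trivializationAt E (TangentSpace I : M → Type _) x₀).symmL ℝ y

lemma mem_baseSet_of_mem_source {x₀ y : M} (hy : y ∈ (extChartAt I x₀).source) :
    y ∈ (trivializationAt E (TangentSpace I : M → Type _) x₀).baseSet := by
  rwa [extChartAt_source] at hy

lemma frameL_apply {x₀ y : M} (hy : y ∈ (extChartAt I x₀).source) (w : E) :
    frameL I x₀ y w = frame x₀ w y :=
  Trivialization.symmL_apply _ (mem_baseSet_of_mem_source hy) w

lemma coord_apply {x₀ y : M} (hy : y ∈ (extChartAt I x₀).source) (v : TangentSpace I y) :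
    coord I x₀ y v = (trivializationAt E (TangentSpace I : M → Type _) x₀ ⟨y, v⟩).2 :=
  Trivialization.continuousLinearMapAt_apply_of_mem _ _ (mem_baseSet_of_mem_source hy) v

lemma coord_frame {x₀ y : M} (hy : y ∈ (extChartAt I x₀).source) (w : E) :
    coord I x₀ y (frame x₀ w y) = w := by
  rw [← frameL_apply hy]
  exact Trivialization.continuousLinearMapAt_symmL _ (mem_baseSet_of_mem_source hy) w

lemma frame_coord {x₀ y : M} (hy : y ∈ (extChartAt I x₀).source) (v : TangentSpace I y) :
    frame x₀ (coord I x₀ y v) y = v := by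
  rw [← frameL_apply hy]
  exact Trivialization.symmL_continuousLinearMapAt _ (mem_baseSet_of_mem_source hy) v

lemma extend_eq_frame {x₀ : M} (v : TangentSpace I x₀) :
    extend E v = (frame x₀ (coord I x₀ x₀ v) : ∀ y : M, TangentSpace I y) := by
  funext y
  simp only [extend, frame, coord_apply (mem_extChartAt_source (I := I) x₀) v]

lemma contMDiffAt_section_iff_coord {x₀ y : M} (hy : y ∈ (extChartAt I x₀).source)
    (Y : ∀ y : M, TangentSpace I y) :
    ContMDiffAt I I.tangent ∞ (fun y => (TotalSpace.mk' E y (Y y) : TangentBundle I M)) y ↔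
      ContMDiffAt I 𝓘(ℝ, E) ∞ (fun y => coord I x₀ y (Y y)) y := by
  rw [Trivialization.contMDiffAt_section_iff (trivializationAt E (TangentSpace I : M → Type _) x₀)
    (mem_baseSet_of_mem_source hy)]
  apply Filter.EventuallyEq.contMDiffAt_iff
  filter_upwards [(isOpen_extChartAt_source (I := I) x₀).mem_nhds hy] with z hz
  rw [coord_apply hz]

lemma mdifferentiableAt_section_iff_coord {x₀ y : M} (hy : y ∈ (extChartAt I x₀).source)
    (Y : ∀ y : M, TangentSpace I y) :
    MDifferentiableAt I I.tangent (fun y => (TotalSpace.mk' E y (Y y) : TangentBundle I M)) y ↔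
      MDifferentiableAt I 𝓘(ℝ, E) (fun y => coord I x₀ y (Y y)) y := by
  have h := Trivialization.mdifferentiableAt_section_iff I
    (trivializationAt E (TangentSpace I : M → Type _) x₀) Y (mem_baseSet_of_mem_source hy)
  refine h.trans ?_
  apply Filter.EventuallyEq.mdifferentiableAt_iff
  filter_upwards [(isOpen_extChartAt_source (I := I) x₀).mem_nhds hy] with z hz
  rw [coord_apply hz]

lemma contMDiffAt_frame {x₀ y : M} (hy : y ∈ (extChartAt I x₀).source) (w : E) :
    ContMDiffAt I I.tangent ∞
      (fun y => (TotalSpace.mk' E y (frame x₀ w y) : TangentBundle I M)) y := by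
  rw [contMDiffAt_section_iff_coord hy]
  refine (contMDiffAt_const (c := w)).congr_of_eventuallyEq ?_
  filter_upwards [(isOpen_extChartAt_source (I := I) x₀).mem_nhds hy] with z hz
  rw [coord_frame hz]

lemma mdifferentiableAt_frame {x₀ y : M} (hy : y ∈ (extChartAt I x₀).source) (w : E) :
    MDifferentiableAt I I.tangent
      (fun y => (TotalSpace.mk' E y (frame x₀ w y) : TangentBundle I M)) y :=
  (contMDiffAt_frame hy w).mdifferentiableAt (by simp)

variable [I.Boundaryless]

lemma frame_eq_mfderiv {x₀ y : M} (hy : y ∈ (extChartAt I x₀).source) (w : E) :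
    frame (I := I) x₀ w y =
      mfderiv 𝓘(ℝ, E) I (extChartAt I x₀).symm (extChartAt I x₀ y) w := by
  have hy' := hy
  rw [extChartAt_source] at hy'
  rw [← frameL_apply hy, frameL, TangentBundle.symmL_trivializationAt hy', I.range_eq_univ,
    mfderivWithin_univ]
  rfl

lemma mdifferentiableAt_extChartAt_symm {x₀ : M} {q : E} (hq : q ∈ (extChartAt I x₀).target) :
    MDifferentiableAt 𝓘(ℝ, E) I (extChartAt I x₀).symm q :=
  ((contMDiffOn_extChartAt_symm (n := ∞) x₀ q hq).contMDiffAt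
    ((isOpen_extChartAt_target x₀).mem_nhds hq)).mdifferentiableAt (by simp)

variable {F : Type*} [NormedAddCommGroup F] [NormedSpace ℝ F]

/-- The chain rule through the inverse chart, whose differential carries constant vectors to
coordinate fields. Derivatives on the manifold become ordinary `fderiv`s on the model space in this
way. -/
lemma mvfderiv_frame {h : M → F} {x₀ y : M} (hy : y ∈ (extChartAt I x₀).source)
    (hh : MDifferentiableAt I 𝓘(ℝ, F) h y) (w : E) :
    mvfderiv I h y (frame x₀ w y) =
      fderiv ℝ (h ∘ (extChartAt I x₀).symm) (extChartAt I x₀ y) w := by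
  have hy' := (extChartAt I x₀).map_source hy
  have e := (extChartAt I x₀).left_inv hy
  rw [← mfderiv_eq_fderiv, mfderiv_comp_of_eq hh (mdifferentiableAt_extChartAt_symm hy') e,
    frame_eq_mfderiv hy]
  simp only [mvfderiv]
  rw [e]
  rfl

lemma mvfderiv_eq_fderiv_coord {h : M → F} {x₀ y : M} (hy : y ∈ (extChartAt I x₀).source)
    (hh : MDifferentiableAt I 𝓘(ℝ, F) h y) (u : TangentSpace I y) :
    mvfderiv I h y u =
      fderiv ℝ (h ∘ (extChartAt I x₀).symm) (extChartAt I x₀ y) (coord I x₀ y u) := by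
  rw [← mvfderiv_frame hy hh, frame_coord hy]

lemma contDiffAt_comp_symm {h : M → F} {x₀ : M} {q : E} (hq : q ∈ (extChartAt I x₀).target)
    (hh : ContMDiffAt I 𝓘(ℝ, F) ∞ h ((extChartAt I x₀).symm q)) :
    ContDiffAt ℝ ∞ (h ∘ (extChartAt I x₀).symm) q := by
  rw [← contMDiffAt_iff_contDiffAt]
  exact hh.comp q ((contMDiffOn_extChartAt_symm (n := ∞) x₀ q hq).contMDiffAt
    ((isOpen_extChartAt_target x₀).mem_nhds hq))

end Frame

/-! ### Christoffel symbols of a connection and their smoothness -/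

section Christoffel

variable {E : Type*} [NormedAddCommGroup E] [NormedSpace ℝ E] [FiniteDimensional ℝ E]
  {H : Type*} [TopologicalSpace H] {I : ModelWithCorners ℝ E H} [I.Boundaryless]
  {M : Type*} [TopologicalSpace M] [ChartedSpace H M] [IsManifold I ∞ M]

/-- Coordinate fields are chart pullbacks of constant fields, pullback commutes with the bracket,
and constant fields commute. Hence the bracket term drops out of both torsion and curvature. -/
lemma mlieBracket_frame {x₀ y : M} (hy : y ∈ (extChartAt I x₀).source) (v w : E) :
    VectorField.mlieBracket I (frame (I := I) x₀ v) (frame x₀ w) y = 0 := by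
  have : IsManifold I (minSmoothness ℝ 2) M := by
    rw [minSmoothness_of_isRCLikeNormedField]
    exact IsManifold.of_le (n := ∞) (WithTop.coe_le_coe.2 le_top)
  let C : E → ∀ q : E, TangentSpace 𝓘(ℝ, E) q := fun w _ => w
  have key : ∀ w : E, ∀ᶠ z in 𝓝 y, frame (I := I) x₀ w z =
      VectorField.mpullback I 𝓘(ℝ, E) (extChartAt I x₀) (C w) z := by
    intro w
    filter_upwards [(isOpen_extChartAt_source (I := I) x₀).mem_nhds hy] with z hz
    rw [VectorField.mpullback_apply, eq_comm,
      (isInvertible_mfderiv_extChartAt hz).inverse_apply_eq]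
    have hz' := hz
    rw [extChartAt_source] at hz'
    have h := coord_frame (I := I) hz w
    rw [coord, TangentBundle.continuousLinearMapAt_trivializationAt hz'] at h
    exact h.symm
  have hc : ∀ w : E, MDifferentiableAt 𝓘(ℝ, E) 𝓘(ℝ, E).tangent
      (fun q => (TotalSpace.mk' E q (C w q) : TangentBundle 𝓘(ℝ, E) E)) (extChartAt I x₀ y) := by
    intro w
    exact (contMDiffAt_vectorSpace_iff_contDiffAt (n := ∞) (V := C w)).2 contDiffAt_const
      |>.mdifferentiableAt (by simp)
  have hb := VectorField.mpullback_mlieBracket (I := I) (I' := 𝓘(ℝ, E)) (n := ∞)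
    (f := extChartAt I x₀) (x₀ := y) (hc v) (hc w)
    ((contMDiffOn_extChartAt (n := ∞)).contMDiffAt
      ((chartAt H x₀).open_source.mem_nhds (by rwa [extChartAt_source] at hy)))
    (by rw [minSmoothness_of_isRCLikeNormedField]; exact WithTop.coe_le_coe.2 le_top)
  rw [Filter.EventuallyEq.mlieBracket_vectorField_eq (key v) (key w), ← hb,
    VectorField.mpullback_apply]
  have h0 : VectorField.mlieBracket 𝓘(ℝ, E) (C v) (C w) (extChartAt I x₀ y) = 0 := by
    rw [← VectorField.mlieBracketWithin_univ, VectorField.mlieBracketWithin_eq_lieBracketWithin,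
      VectorField.lieBracketWithin_univ, VectorField.lieBracket]
    have hz : ∀ w : E, fderiv ℝ (C w) (extChartAt I x₀ y) = 0 := fun w =>
      fderiv_const_apply (F := E) w
    erw [hz, hz]
    exact sub_self (0 : E)
  rw [h0, map_zero]

lemma cov_congr (cov : AffineConnection I M) {Y Z : ∀ y : M, TangentSpace I y} {y : M}
    (hY : MDifferentiableAt I I.tangent (fun y => (TotalSpace.mk' E y (Y y) : TangentBundle I M)) y)
    (hZ : MDifferentiableAt I I.tangent (fun y => (TotalSpace.mk' E y (Z y) : TangentBundle I M)) y)
    (h : ∀ᶠ z in 𝓝 y, Y z = Z z) : cov Y y = cov Z y :=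
  cov.isCovariantDerivativeOn.congr_of_eventuallyEq hY hZ univ_mem h

lemma cov_sum (cov : AffineConnection I M) {ι : Type*} (s : Finset ι)
    (Y : ι → ∀ y : M, TangentSpace I y) {y : M}
    (hY : ∀ i, MDifferentiableAt I I.tangent
      (fun y => (TotalSpace.mk' E y (Y i y) : TangentBundle I M)) y) :
    cov (fun z => ∑ i ∈ s, Y i z) y = ∑ i ∈ s, cov (Y i) y := by
  classical
  induction s using Finset.induction_on with
  | empty =>
    simp only [Finset.sum_empty]
    exact congrFun cov.zero y
  | insert i s hi ih =>
    simp only [Finset.sum_insert hi, ← ih]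
    exact cov.isCovariantDerivativeOnUniv.add (hY i)
      (MDifferentiableAt.sum_section (fun i _ => hY i))

/-- The Christoffel symbols of a connection in the chart at `x₀`: `christoffel cov x₀ q w u` is
the coordinate expression of `∇_u w` at the point with coordinates `q`, for fields with constant
coefficients. -/
def christoffel (cov : AffineConnection I M) (x₀ : M) (q : E) : E →L[ℝ] E →L[ℝ] E :=
  ∑ i, (LinearMap.toContinuousLinearMap ((Module.finBasis ℝ E).coord i)).smulRight
    (coord I x₀ ((extChartAt I x₀).symm q) ∘L
      cov (frame x₀ (Module.finBasis ℝ E i)) ((extChartAt I x₀).symm q) ∘L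
        frameL I x₀ ((extChartAt I x₀).symm q))

lemma mdifferentiableAt_coord {x₀ y : M} (hy : y ∈ (extChartAt I x₀).source)
    {Y : ∀ y : M, TangentSpace I y}
    (hY : MDifferentiableAt I I.tangent
      (fun y => (TotalSpace.mk' E y (Y y) : TangentBundle I M)) y) :
    MDifferentiableAt I 𝓘(ℝ, E) (fun y => coord I x₀ y (Y y)) y :=
  (mdifferentiableAt_section_iff_coord hy Y).1 hY

/-- Expanding `Y` in the coordinate frame near `y` and applying the Leibniz rule to each summand
separates the derivative of the coefficients from the Christoffel term. -/
lemma coord_cov (cov : AffineConnection I M) {x₀ y : M} (hy : y ∈ (extChartAt I x₀).source)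
    {Y : ∀ y : M, TangentSpace I y}
    (hY : MDifferentiableAt I I.tangent
      (fun y => (TotalSpace.mk' E y (Y y) : TangentBundle I M)) y) (u : TangentSpace I y) :
    coord I x₀ y (cov Y y u) = mvfderiv I (fun z => coord I x₀ z (Y z)) y u
      + christoffel cov x₀ (extChartAt I x₀ y) (coord I x₀ y (Y y)) (coord I x₀ y u) := by
  set b := Module.finBasis ℝ E
  set β : Fin _ → E →L[ℝ] ℝ := fun i => LinearMap.toContinuousLinearMap (b.coord i)
  have hc := mdifferentiableAt_coord hy hY
  have hg : ∀ i, MDifferentiableAt I 𝓘(ℝ) (fun z => β i (coord I x₀ z (Y z))) y := fun i =>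
    (β i).mdifferentiableAt.comp y hc
  have hfr : ∀ i, MDifferentiableAt I I.tangent (fun z => (TotalSpace.mk' E z
      (((fun z => β i (coord I x₀ z (Y z))) • frame (I := I) x₀ (b i)) z) : TangentBundle I M)) y :=
    fun i => (hg i).smul_section (mdifferentiableAt_frame hy (b i))
  have hE : ∀ᶠ z in 𝓝 y, Y z =
      ∑ i, ((fun z => β i (coord I x₀ z (Y z))) • frame (I := I) x₀ (b i)) z := by
    filter_upwards [(isOpen_extChartAt_source (I := I) x₀).mem_nhds hy] with z hz
    conv_lhs => rw [← frame_coord hz (Y z), ← b.sum_repr (coord I x₀ z (Y z)), ← frameL_apply hz,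
      map_sum]
    refine Finset.sum_congr rfl fun i _ => ?_
    rw [map_smul, frameL_apply hz]
    rfl
  have hder : ∀ i, mvfderiv I (fun z => β i (coord I x₀ z (Y z))) y u =
      β i (mvfderiv I (fun z => coord I x₀ z (Y z)) y u) := by
    intro i
    have := mfderiv_comp_apply y (β i).mdifferentiableAt hc u
    simp only [mvfderiv]
    erw [this]
    rw [ContinuousLinearMap.mfderiv_eq]
    rfl
  rw [cov_congr cov hY (MDifferentiableAt.sum_section (fun i _ => hfr i)) hE,
    cov_sum cov _ _ hfr]
  simp only [fun i => cov.isCovariantDerivativeOnUniv.leibniz (mdifferentiableAt_frame hy (b i))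
    (hg i)]
  simp only [sum_apply, map_sum, add_apply,
    smul_apply, ContinuousLinearMap.smulRight_apply, map_add, map_smul,
    Finset.sum_add_distrib, coord_frame hy, hder]
  rw [add_comm]
  congr 1
  · exact b.sum_repr _
  · rw [christoffel, sum_apply, sum_apply]
    refine Finset.sum_congr rfl fun i _ => ?_
    simp only [ContinuousLinearMap.smulRight_apply, smul_apply,
      ContinuousLinearMap.comp_apply]
    rw [(extChartAt I x₀).left_inv hy, frameL_apply hy, frame_coord hy]

lemma mvfderiv_coord_frame {x₀ y : M} (hy : y ∈ (extChartAt I x₀).source) (w : E) :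
    mvfderiv I (fun z => coord I x₀ z (frame x₀ w z)) y = 0 := by
  have h : (fun z => coord I x₀ z (frame x₀ w z)) =ᶠ[𝓝 y] fun _ => w := by
    filter_upwards [(isOpen_extChartAt_source (I := I) x₀).mem_nhds hy] with z hz
    rw [coord_frame hz]
  have := mvfderiv_const (I := I) w (x := y)
  rw [mvfderiv] at this ⊢
  rw [h.mfderiv_eq, coord_frame hy]
  exact this

lemma coord_cov_frame (cov : AffineConnection I M) {x₀ y : M}
    (hy : y ∈ (extChartAt I x₀).source) (w : E) (u : TangentSpace I y) :
    coord I x₀ y (cov (frame x₀ w) y u) =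
      christoffel cov x₀ (extChartAt I x₀ y) w (coord I x₀ y u) := by
  rw [coord_cov cov hy (mdifferentiableAt_frame hy w), mvfderiv_coord_frame hy, coord_frame hy]
  simp

lemma cov_frame (cov : AffineConnection I M) {x₀ y : M}
    (hy : y ∈ (extChartAt I x₀).source) (w u : E) :
    cov (frame x₀ w) y (frame x₀ u y) = frame x₀ (christoffel cov x₀ (extChartAt I x₀ y) w u) y := by
  rw [← frame_coord hy (cov (frame x₀ w) y (frame x₀ u y)), coord_cov_frame cov hy, coord_frame hy]

variable [T2Space M]

/-- Smoothness of a connection speaks of globally smooth sections, while a coordinate field is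
smooth only on its chart domain. A bump function supported in that domain makes it global, and
locality of the connection removes the bump function again. -/
lemma contMDiffAt_cov_frame {cov : AffineConnection I M}
    (hcov : cov.ContMDiffCovariantDerivative ∞) {x₀ y : M} (hy : y ∈ (extChartAt I x₀).source)
    (w u : E) : ContMDiffAt I I.tangent ∞ (fun y => (TotalSpace.mk' E y
      (cov (frame x₀ w) y (frame x₀ u y)) : TangentBundle I M)) y := by
  have hs := isOpen_extChartAt_source (I := I) x₀
  obtain ⟨f, -, hf⟩ := (SmoothBumpFunction.nhds_basis_tsupport (I := I) y).mem_iff.1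
    (hs.mem_nhds hy)
  have hF : ContMDiff I I.tangent ∞ (fun z => (TotalSpace.mk' E z
      (((f : M → ℝ) • frame (I := I) x₀ w) z) : TangentBundle I M)) :=
    ContMDiffOn.smul_section_of_tsupport f.contMDiff.contMDiffOn hs hf
      (fun z hz => (contMDiffAt_frame hz w).contMDiffWithinAt)
  have h1 := (hcov.contMDiff.contMDiff (σ := (f : M → ℝ) • frame (I := I) x₀ w)
    (by simpa using! hF.contMDiffOn)).contMDiffAt (x := y) univ_mem
  have h2 := h1.clm_bundle_apply (contMDiffAt_frame hy u)
  refine h2.congr_of_eventuallyEq ?_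
  -- The bump function must equal 1 on a neighbourhood of every point close to `y`, so that locality
  -- applies at those points too.
  have hf1 := (f.eventuallyEq_one).eventually_nhds
  filter_upwards [hf1, hs.mem_nhds hy] with z hz hzs
  have : cov (frame x₀ w) z = cov ((f : M → ℝ) • frame (I := I) x₀ w) z := by
    refine cov_congr cov (mdifferentiableAt_frame hzs w)
      (hF.mdifferentiableAt (by simp)) ?_
    filter_upwards [hz] with a ha
    simp [ha]
  rw [this]

lemma contDiffOn_christoffel {cov : AffineConnection I M}
    (hcov : cov.ContMDiffCovariantDerivative ∞) (x₀ : M) :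
    ContDiffOn ℝ ∞ (christoffel cov x₀) (extChartAt I x₀).target := by
  rw [contDiffOn_clm_apply]
  intro w
  rw [contDiffOn_clm_apply]
  intro u q hq
  have hy := (extChartAt I x₀).map_target hq
  have h := (contMDiffAt_section_iff_coord hy _).1 (contMDiffAt_cov_frame hcov hy w u)
  refine ((contDiffAt_comp_symm hq h).congr_of_eventuallyEq ?_).contDiffWithinAt
  filter_upwards [(isOpen_extChartAt_target (I := I) x₀).mem_nhds hq] with z hz
  have hz' := (extChartAt I x₀).map_target hz
  simp only [Function.comp_apply]
  rw [coord_cov_frame cov hz', coord_frame hz', (extChartAt I x₀).right_inv hz]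

end Christoffel

/-! ### Derivatives of operator-valued maps evaluated at constants -/

section ApplyConst

variable {E F G K : Type*} [NormedAddCommGroup E] [NormedSpace ℝ E] [NormedAddCommGroup F]
  [NormedSpace ℝ F] [NormedAddCommGroup G] [NormedSpace ℝ G] [NormedAddCommGroup K]
  [NormedSpace ℝ K]

lemma hasFDerivAt_apply_const {L : E → F →L[ℝ] G} {L' : E →L[ℝ] F →L[ℝ] G} {p : E}
    (h : HasFDerivAt L L' p) (v : F) : HasFDerivAt (fun q => L q v) (L'.flip v) p :=
  (ContinuousLinearMap.apply ℝ G v).hasFDerivAt.comp p h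

lemma fderiv_apply_const {L : E → F →L[ℝ] G} {p : E} (h : DifferentiableAt ℝ L p) (u : E) (v : F) :
    fderiv ℝ (fun q => L q v) p u = fderiv ℝ L p u v := by
  rw [(hasFDerivAt_apply_const h.hasFDerivAt v).fderiv]
  rfl

lemma fderiv_apply_apply_const {L : E → F →L[ℝ] G →L[ℝ] K} {p : E} (h : DifferentiableAt ℝ L p)
    (u : E) (v : F) (w : G) : fderiv ℝ (fun q => L q v w) p u = fderiv ℝ L p u v w := by
  rw [(hasFDerivAt_apply_const (hasFDerivAt_apply_const h.hasFDerivAt v) w).fderiv]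
  rfl

end ApplyConst

/-! ### Torsion and curvature in coordinates -/

section CoordCurvature

variable {E : Type*} [NormedAddCommGroup E] [NormedSpace ℝ E]

/-- The curvature tensor at `p` of the connection with Christoffel symbols `Γ`. -/
def coordCurvature (Γ : E → E →L[ℝ] E →L[ℝ] E) (p u v w : E) : E :=
  fderiv ℝ Γ p u w v - fderiv ℝ Γ p v w u + Γ p (Γ p w v) u - Γ p (Γ p w u) v

variable [FiniteDimensional ℝ E]
  {H : Type*} [TopologicalSpace H] {I : ModelWithCorners ℝ E H} [I.Boundaryless]
  {M : Type*} [TopologicalSpace M] [ChartedSpace H M] [IsManifold I ∞ M]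

lemma christoffel_symm {cov : AffineConnection I M} (h : cov.torsion = 0) {x₀ : M} {q : E}
    (hq : q ∈ (extChartAt I x₀).target) (v w : E) :
    christoffel cov x₀ q v w = christoffel cov x₀ q w v := by
  have hy := (extChartAt I x₀).map_target hq
  have := (cov.torsion_eq_zero_iff.1 h) (mdifferentiableAt_frame hy v) (mdifferentiableAt_frame hy w)
  rw [mlieBracket_frame hy, sub_eq_zero] at this
  have := congrArg (coord I x₀ _) this
  rw [coord_cov_frame cov hy, coord_cov_frame cov hy, coord_frame hy, coord_frame hy,
    (extChartAt I x₀).right_inv hq] at this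
  exact this.symm

variable [T2Space M]

lemma differentiableAt_christoffel {cov : AffineConnection I M}
    (hcov : cov.ContMDiffCovariantDerivative ∞) {x₀ : M} {q : E}
    (hq : q ∈ (extChartAt I x₀).target) : DifferentiableAt ℝ (christoffel cov x₀) q :=
  ((contDiffOn_christoffel hcov x₀).contDiffAt
    ((isOpen_extChartAt_target x₀).mem_nhds hq)).differentiableAt (by simp)

lemma coord_cov_cov_frame {cov : AffineConnection I M}
    (hcov : cov.ContMDiffCovariantDerivative ∞) {x₀ y : M} (hx : y ∈ (extChartAt I x₀).source)
    (v w : E) (u : TangentSpace I y) :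
    coord I x₀ y (cov (fun y => cov (frame x₀ w) y (frame x₀ v y)) y u) =
      fderiv ℝ (christoffel cov x₀) (extChartAt I x₀ y) (coord I x₀ y u) w v
        + christoffel cov x₀ (extChartAt I x₀ y)
          (christoffel cov x₀ (extChartAt I x₀ y) w v) (coord I x₀ y u) := by
  have hp := (extChartAt I x₀).map_source hx
  have hd := (contMDiffAt_cov_frame hcov hx w v).mdifferentiableAt (by simp)
  rw [coord_cov cov hx hd u, mvfderiv_eq_fderiv_coord hx (mdifferentiableAt_coord hx hd) u,
    coord_cov_frame cov hx, coord_frame hx]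
  have hE : ((fun z => coord I x₀ z (cov (frame x₀ w) z (frame x₀ v z))) ∘ (extChartAt I x₀).symm)
      =ᶠ[𝓝 (extChartAt I x₀ y)] fun q => christoffel cov x₀ q w v := by
    filter_upwards [(isOpen_extChartAt_target (I := I) x₀).mem_nhds hp] with z hz
    have hz' := (extChartAt I x₀).map_target hz
    simp only [Function.comp_apply]
    rw [coord_cov_frame cov hz', coord_frame hz', (extChartAt I x₀).right_inv hz]
  rw [hE.fderiv_eq, fderiv_apply_apply_const (differentiableAt_christoffel hcov hp)]

/-- The fields used in `curvature` are coordinate fields of the chart at the base point, so no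
independence of the extension has to be proved: their bracket vanishes and the iterated derivatives
are known. -/
lemma coord_curvature {cov : AffineConnection I M}
    (hcov : cov.ContMDiffCovariantDerivative ∞) (x₀ : M) (u v w : TangentSpace I x₀) :
    coord I x₀ x₀ (curvature cov x₀ u v w) =
      coordCurvature (christoffel cov x₀) (extChartAt I x₀ x₀)
        (coord I x₀ x₀ u) (coord I x₀ x₀ v) (coord I x₀ x₀ w) := by
  have hx := mem_extChartAt_source (I := I) x₀
  simp only [curvature, extend_eq_frame]
  rw [mlieBracket_frame hx, map_zero, sub_zero, map_sub, coord_cov_cov_frame hcov hx,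
    coord_cov_cov_frame hcov hx, coordCurvature]
  abel

end CoordCurvature

/-! ### The metric and its covariant derivative in coordinates -/

section Metric

variable {E : Type*} [NormedAddCommGroup E] [NormedSpace ℝ E] [FiniteDimensional ℝ E]
  {H : Type*} [TopologicalSpace H] {I : ModelWithCorners ℝ E H} [I.Boundaryless]
  {M : Type*} [TopologicalSpace M] [ChartedSpace H M] [IsManifold I ∞ M]
  [RiemannianBundle (fun x : M => TangentSpace I x)]

/-- The coefficients of the metric in the chart at `x₀`. -/
def metric (I : ModelWithCorners ℝ E H) [IsManifold I ∞ M]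
    [RiemannianBundle (fun x : M => TangentSpace I x)] (x₀ : M) (q : E) : E →L[ℝ] E →L[ℝ] ℝ :=
  (innerSL ℝ (E := TangentSpace I ((extChartAt I x₀).symm q))).bilinearComp
    (frameL I x₀ ((extChartAt I x₀).symm q)) (frameL I x₀ ((extChartAt I x₀).symm q))

lemma metric_extChartAt {x₀ y : M} (hy : y ∈ (extChartAt I x₀).source) (v w : E) :
    metric I x₀ (extChartAt I x₀ y) v w = inner ℝ (frame (I := I) x₀ v y) (frame x₀ w y) := by
  rw [metric, (extChartAt I x₀).left_inv hy, ← frameL_apply hy, ← frameL_apply hy]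
  rfl

lemma metric_coord {x₀ y : M} (hy : y ∈ (extChartAt I x₀).source) (v w : TangentSpace I y) :
    metric I x₀ (extChartAt I x₀ y) (coord I x₀ y v) (coord I x₀ y w) = inner ℝ v w := by
  rw [metric_extChartAt hy, frame_coord hy, frame_coord hy]

lemma metric_symm {x₀ : M} (q : E) (v w : E) : metric I x₀ q v w = metric I x₀ q w v :=
  real_inner_comm (F := TangentSpace I ((extChartAt I x₀).symm q)) _ _

variable [IsContMDiffRiemannianBundle I ∞ E (fun x : M => TangentSpace I x)]

lemma contMDiffAt_inner_frame {x₀ y : M} (hy : y ∈ (extChartAt I x₀).source) (v w : E) :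
    ContMDiffAt I 𝓘(ℝ) ∞ (fun y => (inner ℝ (frame (I := I) x₀ v y) (frame x₀ w y) : ℝ)) y :=
  ContMDiffAt.inner_bundle (E := fun x : M => TangentSpace I x)
    (contMDiffAt_frame hy v) (contMDiffAt_frame hy w)

lemma contDiffOn_metric (x₀ : M) :
    ContDiffOn ℝ ∞ (metric I x₀) (extChartAt I x₀).target := by
  rw [contDiffOn_clm_apply]
  intro v
  rw [contDiffOn_clm_apply]
  intro w q hq
  have hy := (extChartAt I x₀).map_target hq
  have h := contMDiffAt_inner_frame hy v w
  refine ((contDiffAt_comp_symm hq h).congr_of_eventuallyEq ?_).contDiffWithinAt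
  filter_upwards [(isOpen_extChartAt_target (I := I) x₀).mem_nhds hq] with z hz
  have hz' := (extChartAt I x₀).map_target hz
  have := metric_extChartAt hz' v w
  rwa [(extChartAt I x₀).right_inv hz] at this

lemma differentiableAt_metric {x₀ : M} {q : E}
    (hq : q ∈ (extChartAt I x₀).target) : DifferentiableAt ℝ (metric I x₀) q :=
  ((contDiffOn_metric x₀).contDiffAt
    ((isOpen_extChartAt_target x₀).mem_nhds hq)).differentiableAt (by simp)

lemma metricDeriv_frame (cov : AffineConnection I M) {x₀ : M} {q : E}
    (hq : q ∈ (extChartAt I x₀).target) (u v w : E) :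
    metricDeriv cov ((extChartAt I x₀).symm q) (frame x₀ u _) (frame x₀ v) (frame x₀ w) =
      fderiv ℝ (metric I x₀) q u v w - metric I x₀ q (christoffel cov x₀ q v u) w
        - metric I x₀ q v (christoffel cov x₀ q w u) := by
  have hy := (extChartAt I x₀).map_target hq
  have h := contMDiffAt_inner_frame hy v w
  rw [metricDeriv, mvfderiv_frame hy (h.mdifferentiableAt (by simp)), cov_frame cov hy,
    cov_frame cov hy, ← metric_extChartAt hy, ← metric_extChartAt hy, (extChartAt I x₀).right_inv hq]
  have hE : ((fun y => (inner ℝ (frame (I := I) x₀ v y) (frame x₀ w y) : ℝ)) ∘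
      (extChartAt I x₀).symm) =ᶠ[𝓝 q] fun q => metric I x₀ q v w := by
    filter_upwards [(isOpen_extChartAt_target (I := I) x₀).mem_nhds hq] with z hz
    have := metric_extChartAt ((extChartAt I x₀).map_target hz) v w
    rw [(extChartAt I x₀).right_inv hz] at this
    exact this.symm
  rw [hE.fderiv_eq, fderiv_apply_apply_const (differentiableAt_metric (I := I) hq)]

end Metric

/-! ### Product rules and symmetry of second derivatives -/

section ProductRule

variable {E F G K : Type*} [NormedAddCommGroup E] [NormedSpace ℝ E] [NormedAddCommGroup F]
  [NormedSpace ℝ F] [NormedAddCommGroup G] [NormedSpace ℝ G] [NormedAddCommGroup K]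
  [NormedSpace ℝ K]

lemma fderiv_apply_fun {L : E → F →L[ℝ] G} {X : E → F} {p : E}
    (hL : DifferentiableAt ℝ L p) (hX : DifferentiableAt ℝ X p) (u : E) :
    fderiv ℝ (fun q => L q (X q)) p u = fderiv ℝ L p u (X p) + L p (fderiv ℝ X p u) := by
  rw [fderiv_clm_apply hL hX, add_apply, add_comm]
  rfl

lemma fderiv_apply_apply_fun {L : E → F →L[ℝ] G →L[ℝ] K} {X : E → F} {Y : E → G} {p : E}
    (hL : DifferentiableAt ℝ L p) (hX : DifferentiableAt ℝ X p) (hY : DifferentiableAt ℝ Y p)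
    (u : E) :
    fderiv ℝ (fun q => L q (X q) (Y q)) p u =
      fderiv ℝ L p u (X p) (Y p) + L p (fderiv ℝ X p u) (Y p) + L p (X p) (fderiv ℝ Y p u) := by
  rw [fderiv_apply_fun (L := fun q => L q (X q)) (hL.clm_apply hX) hY, fderiv_apply_fun hL hX,
    add_apply]

/-- The analytic source of the structure equations: applied to metric coefficients it makes the
curvature skew, applied to $J$ it makes curvature and $J$ commute, and applied to an immersion it
yields the Gauss and Codazzi equations. -/
lemma fderiv_fderiv_comm {f : E → F} {p : E} (hf : ContDiffAt ℝ ∞ f p) (u v : E) :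
    fderiv ℝ (fun q => fderiv ℝ f q v) p u = fderiv ℝ (fun q => fderiv ℝ f q u) p v := by
  have hd : DifferentiableAt ℝ (fderiv ℝ f) p :=
    (hf.fderiv_right (m := 1) (by exact WithTop.coe_le_coe.2 le_top)).differentiableAt (by simp)
  rw [fderiv_apply_const hd, fderiv_apply_const hd]
  exact (hf.isSymmSndFDerivAt (by
    rw [minSmoothness_of_isRCLikeNormedField]; exact WithTop.coe_le_coe.2 le_top)) u v

lemma differentiableAt_fderiv {f : E → F} {p : E} (hf : ContDiffAt ℝ ∞ f p) :
    DifferentiableAt ℝ (fderiv ℝ f) p :=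
  (hf.fderiv_right (m := 1) (by exact WithTop.coe_le_coe.2 le_top)).differentiableAt (by simp)

lemma contDiffAt_fderiv_apply {f : E → F} {p : E} (hf : ContDiffAt ℝ ∞ f p) (v : E) :
    ContDiffAt ℝ ∞ (fun q => fderiv ℝ f q v) p :=
  (hf.fderiv_right (m := ∞) (by simp)).clm_apply contDiffAt_const

end ProductRule

/-! ### Levi-Civita connection on an open set: curvature symmetries -/

section LeviCivita

variable {E : Type*} [NormedAddCommGroup E] [NormedSpace ℝ E]

/-- `Γ` are the Christoffel symbols of the Levi-Civita connection of the metric with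
coefficients `G` on the open set `O`. -/
structure IsCoordLeviCivita (G : E → E →L[ℝ] E →L[ℝ] ℝ) (Γ : E → E →L[ℝ] E →L[ℝ] E)
    (O : Set E) : Prop where
  isOpen : IsOpen O
  contDiffOn_metric : ContDiffOn ℝ ∞ G O
  contDiffOn_christoffel : ContDiffOn ℝ ∞ Γ O
  metric_symm : ∀ q v w, G q v w = G q w v
  christoffel_symm : ∀ q ∈ O, ∀ v w, Γ q v w = Γ q w v
  fderiv_metric : ∀ q ∈ O, ∀ u v w,
    fderiv ℝ G q u v w = G q (Γ q v u) w + G q v (Γ q w u)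

lemma coordCurvature_swap (Γ : E → E →L[ℝ] E →L[ℝ] E) (p u v w : E) :
    coordCurvature Γ p v u w = - coordCurvature Γ p u v w := by
  simp only [coordCurvature]
  abel

namespace IsCoordLeviCivita

variable {G : E → E →L[ℝ] E →L[ℝ] ℝ} {Γ : E → E →L[ℝ] E →L[ℝ] E} {O : Set E} {p : E}

lemma contDiffAt_metric (h : IsCoordLeviCivita G Γ O) (hp : p ∈ O) : ContDiffAt ℝ ∞ G p :=
  h.contDiffOn_metric.contDiffAt (h.isOpen.mem_nhds hp)

lemma differentiableAt_metric (h : IsCoordLeviCivita G Γ O) (hp : p ∈ O) :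
    DifferentiableAt ℝ G p := (h.contDiffAt_metric hp).differentiableAt (by simp)

lemma differentiableAt_christoffel (h : IsCoordLeviCivita G Γ O) (hp : p ∈ O) :
    DifferentiableAt ℝ Γ p :=
  (h.contDiffOn_christoffel.contDiffAt (h.isOpen.mem_nhds hp)).differentiableAt (by simp)

lemma differentiableAt_christoffel_apply (h : IsCoordLeviCivita G Γ O) (hp : p ∈ O) (v w : E) :
    DifferentiableAt ℝ (fun q => Γ q v w) p :=
  ((h.differentiableAt_christoffel hp).clm_apply (differentiableAt_const v)).clm_apply
    (differentiableAt_const w)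

lemma fderiv_christoffel_symm (h : IsCoordLeviCivita G Γ O) (hp : p ∈ O) (u v w : E) :
    fderiv ℝ Γ p u v w = fderiv ℝ Γ p u w v := by
  have hΓ := h.differentiableAt_christoffel hp
  rw [← fderiv_apply_apply_const hΓ, ← fderiv_apply_apply_const hΓ]
  have : (fun q => Γ q v w) =ᶠ[𝓝 p] fun q => Γ q w v := by
    filter_upwards [h.isOpen.mem_nhds hp] with q hq using h.christoffel_symm q hq v w
  rw [this.fderiv_eq]

lemma bianchi (h : IsCoordLeviCivita G Γ O) (hp : p ∈ O) (u v w : E) :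
    coordCurvature Γ p u v w + coordCurvature Γ p v w u + coordCurvature Γ p w u v = 0 := by
  simp only [coordCurvature]
  rw [h.fderiv_christoffel_symm hp u w v, h.fderiv_christoffel_symm hp v w u,
    h.fderiv_christoffel_symm hp w v u, h.christoffel_symm p hp w v, h.christoffel_symm p hp w u,
    h.christoffel_symm p hp v u]
  abel

/-- The second derivatives of $g(w,t)$ commute. Metric compatibility expresses both through
$\Gamma$; the mixed terms such as $g(\Gamma(w,v),\Gamma(t,u))$ occur in pairs symmetric in `u`, `v`,
and only the curvature survives. -/
lemma metric_coordCurvature (h : IsCoordLeviCivita G Γ O) (hp : p ∈ O) (u v w t : E) :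
    G p (coordCurvature Γ p u v w) t + G p w (coordCurvature Γ p u v t) = 0 := by
  have hG := h.differentiableAt_metric hp
  have hΓ := h.differentiableAt_christoffel hp
  have key : ∀ u v, fderiv ℝ (fun q => fderiv ℝ (fun q => G q w t) q v) p u =
      G p (Γ p (Γ p w v) u) t + G p (Γ p w v) (Γ p t u) + G p (fderiv ℝ Γ p u w v) t
      + (G p (Γ p w u) (Γ p t v) + G p w (Γ p (Γ p t v) u) + G p w (fderiv ℝ Γ p u t v)) := by
    intro u v
    have hE : (fun q => fderiv ℝ (fun q => G q w t) q v) =ᶠ[𝓝 p]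
        (fun q => G q (Γ q w v) t) + fun q => G q w (Γ q t v) := by
      filter_upwards [h.isOpen.mem_nhds hp] with q hq
      rw [fderiv_apply_apply_const (h.differentiableAt_metric hq), h.fderiv_metric q hq]
      rfl
    have h1 := h.differentiableAt_christoffel_apply hp w v
    have h2 := h.differentiableAt_christoffel_apply hp t v
    rw [hE.fderiv_eq, fderiv_add ((hG.clm_apply h1).clm_apply (differentiableAt_const t))
      ((hG.clm_apply (differentiableAt_const w)).clm_apply h2), add_apply,
      fderiv_apply_apply_fun hG h1 (differentiableAt_const t),
      fderiv_apply_apply_fun hG (differentiableAt_const w) h2,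
      fderiv_apply_apply_const hΓ, fderiv_apply_apply_const hΓ, h.fderiv_metric p hp,
      h.fderiv_metric p hp]
    simp
  have hs := fderiv_fderiv_comm (((h.contDiffAt_metric hp).clm_apply
    (contDiffAt_const (c := w))).clm_apply (contDiffAt_const (c := t))) u v
  rw [key, key] at hs
  simp only [coordCurvature, map_add, map_sub, add_apply, sub_apply]
  linarith [h.metric_symm p (Γ p w v) (Γ p t u), h.metric_symm p (Γ p w u) (Γ p t v)]

/-- The curvature tensor commutes with a parallel tensor field `J` of type `(1, 1)`. -/
lemma coordCurvature_parallel (h : IsCoordLeviCivita G Γ O) (hp : p ∈ O) {J : E → E →L[ℝ] E}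
    (hJ : ContDiffOn ℝ ∞ J O)
    (hpar : ∀ q ∈ O, ∀ u w, fderiv ℝ J q u w = J q (Γ q w u) - Γ q (J q w) u) (u v w : E) :
    coordCurvature Γ p u v (J p w) = J p (coordCurvature Γ p u v w) := by
  have hΓ := h.differentiableAt_christoffel hp
  have hJp := hJ.contDiffAt (h.isOpen.mem_nhds hp)
  have hJd := hJp.differentiableAt (by simp)
  have hJw : DifferentiableAt ℝ (fun q => J q w) p := hJd.clm_apply (differentiableAt_const w)
  have key : ∀ u v, fderiv ℝ (fun q => fderiv ℝ (fun q => J q w) q v) p u =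
      J p (Γ p (Γ p w v) u) - Γ p (J p (Γ p w v)) u + J p (fderiv ℝ Γ p u w v)
      - (fderiv ℝ Γ p u (J p w) v + (Γ p (J p (Γ p w u)) v - Γ p (Γ p (J p w) u) v)) := by
    intro u v
    have hE : (fun q => fderiv ℝ (fun q => J q w) q v) =ᶠ[𝓝 p]
        (fun q => J q (Γ q w v)) - fun q => Γ q (J q w) v := by
      filter_upwards [h.isOpen.mem_nhds hp] with q hq
      rw [fderiv_apply_const ((hJ.contDiffAt (h.isOpen.mem_nhds hq)).differentiableAt (by simp)),
        hpar q hq]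
      rfl
    have h1 := h.differentiableAt_christoffel_apply hp w v
    rw [hE.fderiv_eq, fderiv_sub (hJd.clm_apply h1)
      ((hΓ.clm_apply hJw).clm_apply (differentiableAt_const v)), sub_apply,
      fderiv_apply_fun hJd h1, fderiv_apply_apply_fun hΓ hJw (differentiableAt_const v),
      fderiv_apply_apply_const hΓ, fderiv_apply_const hJd, hpar p hp, hpar p hp]
    simp
  -- Second derivatives of $Jw$ commute. By parallelism each is a Christoffel expression, and their
  -- difference is the commutator of the curvature with $J$.
  have hs := fderiv_fderiv_comm (hJp.clm_apply (contDiffAt_const (c := w))) u v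
  rw [key, key] at hs
  simp only [coordCurvature, map_add, map_sub]
  rw [← sub_eq_zero] at hs ⊢
  rw [← neg_eq_zero, ← hs]
  abel

end IsCoordLeviCivita

end LeviCivita

/-! ### Curvature difference of a statistical structure, in coordinates -/

section Statistical

variable {E : Type*} [NormedAddCommGroup E] [NormedSpace ℝ E]
  {G : E → E →L[ℝ] E →L[ℝ] ℝ} {Γ Γ' : E → E →L[ℝ] E →L[ℝ] E} {O : Set E} {p : E}

/-- `(∇_u g)(v, w)` in coordinates. -/
def coordMetricDeriv (G : E → E →L[ℝ] E →L[ℝ] ℝ) (Γ : E → E →L[ℝ] E →L[ℝ] E) (q u v w : E) : ℝ :=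
  fderiv ℝ G q u v w - G q (Γ q v u) w - G q v (Γ q w u)

/-- As $\hat\nabla g=0$, $(\nabla_u g)(w,v)=-g(D(w,u),v)-g(w,D(v,u))$. Exchanging `u` and `w` fixes
the left side and, by symmetry of $D$, the first term on the right; so the last term is symmetric as
well. -/
lemma IsCoordLeviCivita.cubic_symm (h : IsCoordLeviCivita G Γ O) (hp : p ∈ O)
    (hs : ∀ v w, Γ' p v w = Γ' p w v)
    (hc : ∀ u v w, coordMetricDeriv G Γ' p u v w = coordMetricDeriv G Γ' p v u w) (u v w : E) :
    G p ((Γ' - Γ) p u v) w = G p ((Γ' - Γ) p w v) u := by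
  have h1 := hc u w v
  simp only [coordMetricDeriv, h.fderiv_metric p hp] at h1
  simp only [Pi.sub_apply, sub_apply, map_sub]
  rw [hs w u, h.christoffel_symm p hp w u, hs v u, hs v w, h.christoffel_symm p hp v u,
    h.christoffel_symm p hp v w, h.metric_symm p w, h.metric_symm p w, h.metric_symm p u,
    h.metric_symm p u] at h1
  linarith

/-- The right-hand side is arranged so that its first two brackets are exchanged by `u` ↔ `v`. They
contain all derivatives of the cubic form and all Christoffel terms, and vanish after symmetric
summation without normal coordinates or parallel frames. -/
lemma IsCoordLeviCivita.metric_coordCurvature_sub (h : IsCoordLeviCivita G Γ O) (hp : p ∈ O)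
    (hΓ' : DifferentiableAt ℝ Γ' p) (hs : ∀ q ∈ O, ∀ v w, Γ' q v w = Γ' q w v)
    (hc : ∀ q ∈ O, ∀ u v w, coordMetricDeriv G Γ' q u v w = coordMetricDeriv G Γ' q v u w)
    (u v : E) :
    G p (coordCurvature Γ' p u v v) u - G p (coordCurvature Γ p u v v) u =
      (fderiv ℝ (fun q => G q ((Γ' - Γ) q v v) u) p u + G p ((Γ' - Γ) p u u) (Γ p v v))
      - (fderiv ℝ (fun q => G q ((Γ' - Γ) q u u) v) p v + G p ((Γ' - Γ) p v v) (Γ p u u))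
      + G p ((Γ' - Γ) p u u) ((Γ' - Γ) p v v) - G p ((Γ' - Γ) p u v) ((Γ' - Γ) p u v) := by
  have hG := h.differentiableAt_metric hp
  have hΓ := h.differentiableAt_christoffel hp
  have hD : DifferentiableAt ℝ (Γ' - Γ) p :=
    DifferentiableAt.sub (𝕜 := ℝ) (E := E) (F := E →L[ℝ] E →L[ℝ] E) (f := Γ') (g := Γ) hΓ' hΓ
  have hDd : fderiv ℝ (Γ' - Γ) p = fderiv ℝ Γ' p - fderiv ℝ Γ p :=
    fderiv_sub (𝕜 := ℝ) (E := E) (F := E →L[ℝ] E →L[ℝ] E) (f := Γ') (g := Γ) hΓ' hΓ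
  have hDs : ∀ q ∈ O, ∀ v w, (Γ' - Γ) q v w = (Γ' - Γ) q w v := by
    intro q hq v w
    simp only [Pi.sub_apply, sub_apply, hs q hq v w, h.christoffel_symm q hq v w]
  have hA : ∀ q ∈ O, ∀ u v w, G q ((Γ' - Γ) q u v) w = G q ((Γ' - Γ) q w v) u :=
    fun q hq => h.cubic_symm hq (hs q hq) (hc q hq)
  set D := Γ' - Γ with hDdef
  have hΓD : Γ' = Γ + D := by simp [hDdef]
  have hDv : ∀ v w, DifferentiableAt ℝ (fun q => D q v w) p := fun v w =>
    (hD.clm_apply (differentiableAt_const v)).clm_apply (differentiableAt_const w)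
  have dA : ∀ u v w t, fderiv ℝ (fun q => G q (D q v w) t) p u =
      G p (Γ p (D p v w) u) t + G p (D p v w) (Γ p t u) + G p (fderiv ℝ Γ' p u v w) t
        - G p (fderiv ℝ Γ p u v w) t := by
    intro u v w t
    rw [fderiv_apply_apply_fun hG (hDv v w) (differentiableAt_const t),
      fderiv_apply_apply_const hD, h.fderiv_metric p hp, hDd]
    simp only [sub_apply, map_sub, fderiv_fun_const, Pi.zero_apply, zero_apply, map_zero]
    ring
  -- The symmetry of the cubic form holds at all points near `p`, so it may be differentiated. This
  -- brings the second derivative term to the same shape as the first.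
  have e1 : fderiv ℝ (fun q => G q (D q v u) u) p v = fderiv ℝ (fun q => G q (D q u u) v) p v := by
    have : (fun q => G q (D q v u) u) =ᶠ[𝓝 p] fun q => G q (D q u u) v := by
      filter_upwards [h.isOpen.mem_nhds hp] with q hq using hA q hq v u u
    rw [this.fderiv_eq]
  have d1 := dA u v v u
  have d2 := dA v v u u
  rw [e1] at d2
  have hv : Γ' p = Γ p + D p := by rw [hΓD]; rfl
  simp only [coordCurvature, map_add, map_sub, hv, add_apply, sub_apply]
  rw [d1, d2]
  have a1 : G p (D p (Γ p v v) u) u = G p (D p u u) (Γ p v v) := hA p hp _ _ _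
  have a2 : G p (D p (Γ p v u) v) u = G p (D p v u) (Γ p u v) := by
    rw [hA p hp, hDs p hp u v, h.christoffel_symm p hp v u]
  have a3 : G p (D p (D p v v) u) u = G p (D p u u) (D p v v) := hA p hp _ _ _
  have a4 : G p (D p (D p v u) v) u = G p (D p u v) (D p u v) := by
    rw [hA p hp, hDs p hp v u]
  rw [a1, a2, a3, a4]
  rw [h.christoffel_symm p hp u v]
  ring

/-- Cancellation of the brackets needs only that both vectors run through the same finite family.
Orthonormality enters later, when the sums are recognized as scalar curvatures and norms. -/
lemma IsCoordLeviCivita.sum_metric_coordCurvature_sub (h : IsCoordLeviCivita G Γ O) (hp : p ∈ O)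
    (hΓ' : DifferentiableAt ℝ Γ' p) (hs : ∀ q ∈ O, ∀ v w, Γ' q v w = Γ' q w v)
    (hc : ∀ q ∈ O, ∀ u v w, coordMetricDeriv G Γ' q u v w = coordMetricDeriv G Γ' q v u w)
    {ι : Type*} [Fintype ι] (e : ι → E) :
    ∑ j, ∑ i, G p (coordCurvature Γ p (e i) (e j) (e j)) (e i)
      - ∑ j, ∑ i, G p (coordCurvature Γ' p (e i) (e j) (e j)) (e i) =
    ∑ j, ∑ i, G p ((Γ' - Γ) p (e i) (e j)) ((Γ' - Γ) p (e i) (e j))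
      - ∑ j, ∑ i, G p ((Γ' - Γ) p (e i) (e i)) ((Γ' - Γ) p (e j) (e j)) := by
  have key := fun i j => h.metric_coordCurvature_sub hp hΓ' hs hc (e i) (e j)
  have hsum : ∑ j, ∑ i, (G p (coordCurvature Γ' p (e i) (e j) (e j)) (e i)
      - G p (coordCurvature Γ p (e i) (e j) (e j)) (e i)) = _ :=
    Finset.sum_congr rfl fun j _ => Finset.sum_congr rfl fun i _ => key i j
  simp only [Finset.sum_sub_distrib, Finset.sum_add_distrib] at hsum
  rw [Finset.sum_comm (f := fun j i => fderiv ℝ (fun q => G q ((Γ' - Γ) q (e i) (e i)) (e j)) p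
    (e j)), Finset.sum_comm (f := fun j i => G p ((Γ' - Γ) p (e j) (e j)) (Γ p (e i) (e i)))] at hsum
  linarith

end Statistical

/-! ### Isometric immersions in coordinates: Gauss equation -/

section Immersion

variable {E : Type*} [NormedAddCommGroup E] [NormedSpace ℝ E]
  {E' : Type*} [NormedAddCommGroup E'] [NormedSpace ℝ E']
  {G : E → E →L[ℝ] E →L[ℝ] ℝ} {Γ : E → E →L[ℝ] E →L[ℝ] E} {O : Set E} {p : E}
  {G' : E' → E' →L[ℝ] E' →L[ℝ] ℝ} {Γ' : E' → E' →L[ℝ] E' →L[ℝ] E'} {O' : Set E'}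
  {φ : E → E'}

/-- The covariant derivative along `φ` of `dφ(v)` in the direction `u`. -/
def coordSecondDeriv (Γ' : E' → E' →L[ℝ] E' →L[ℝ] E') (φ : E → E') (q u v : E) : E' :=
  fderiv ℝ (fun q => fderiv ℝ φ q v) q u + Γ' (φ q) (fderiv ℝ φ q v) (fderiv ℝ φ q u)

lemma coordSecondDeriv_symm (h' : IsCoordLeviCivita G' Γ' O') {q : E} (hφ : ContDiffAt ℝ ∞ φ q)
    (hq : φ q ∈ O') (u v : E) :
    coordSecondDeriv Γ' φ q u v = coordSecondDeriv Γ' φ q v u := by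
  rw [coordSecondDeriv, coordSecondDeriv, fderiv_fderiv_comm hφ, h'.christoffel_symm _ hq]

/-- Metric compatibility of the covariant derivative along `φ`. The fields `X`, `Y` are only defined
along `φ` and need not extend to the target. -/
lemma fderiv_pullback_metric (h' : IsCoordLeviCivita G' Γ' O') {q : E} (hφ : ContDiffAt ℝ ∞ φ q)
    (hq : φ q ∈ O') {X Y : E → E'} (hX : DifferentiableAt ℝ X q) (hY : DifferentiableAt ℝ Y q)
    (u : E) :
    fderiv ℝ (fun q => G' (φ q) (X q) (Y q)) q u =
      G' (φ q) (fderiv ℝ X q u + Γ' (φ q) (X q) (fderiv ℝ φ q u)) (Y q)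
      + G' (φ q) (X q) (fderiv ℝ Y q u + Γ' (φ q) (Y q) (fderiv ℝ φ q u)) := by
  have hG := h'.differentiableAt_metric hq
  have hd := hφ.differentiableAt (by simp)
  rw [fderiv_apply_apply_fun (L := fun q => G' (φ q))
    (DifferentiableAt.fun_comp' (G := E' →L[ℝ] E' →L[ℝ] ℝ) q hG hd) hX hY]
  have : fderiv ℝ (fun q => G' (φ q)) q u = fderiv ℝ G' (φ q) (fderiv ℝ φ q u) := by
    rw [fderiv_fun_comp (G := E' →L[ℝ] E' →L[ℝ] ℝ) q hG hd]
    rfl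
  rw [this, h'.fderiv_metric _ hq]
  simp only [map_add, add_apply]
  ring

variable (h : IsCoordLeviCivita G Γ O) (h' : IsCoordLeviCivita G' Γ' O')
  (hφ : ContDiffOn ℝ ∞ φ O) (hm : MapsTo φ O O')
  (hiso : ∀ q ∈ O, ∀ v w, G' (φ q) (fderiv ℝ φ q v) (fderiv ℝ φ q w) = G q v w)

include h h' hφ hm hiso

/-- The part of `∇_u dφ(v)` tangent to `φ` is given by the Levi-Civita connection. -/
lemma metric_coordSecondDeriv {q : E} (hq : q ∈ O) (u v t : E) :
    G' (φ q) (coordSecondDeriv Γ' φ q u v) (fderiv ℝ φ q t) = G q (Γ q v u) t := by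
  have hφq := hφ.contDiffAt (h.isOpen.mem_nhds hq)
  have hd : ∀ v, DifferentiableAt ℝ (fun q => fderiv ℝ φ q v) q := fun v =>
    (contDiffAt_fderiv_apply hφq v).differentiableAt (by simp)
  have hX : ∀ u v w, G' (φ q) (coordSecondDeriv Γ' φ q u v) (fderiv ℝ φ q w) - G q (Γ q v u) w
      = -(G' (φ q) (coordSecondDeriv Γ' φ q u w) (fderiv ℝ φ q v) - G q (Γ q w u) v) := by
    intro u v w
    have hE : (fun q => G' (φ q) (fderiv ℝ φ q v) (fderiv ℝ φ q w)) =ᶠ[𝓝 q]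
        fun q => G q v w := by
      filter_upwards [h.isOpen.mem_nhds hq] with q hq using hiso q hq v w
    have h1 := fderiv_pullback_metric h' hφq (hm hq) (hd v) (hd w) u
    rw [hE.fderiv_eq, fderiv_apply_apply_const (h.differentiableAt_metric hq),
      h.fderiv_metric q hq] at h1
    simp only [coordSecondDeriv]
    rw [h.metric_symm q (Γ q w u) v, h'.metric_symm (φ q) _ (fderiv ℝ φ q v)]
    linarith
  have hS : ∀ u v w, G' (φ q) (coordSecondDeriv Γ' φ q u v) (fderiv ℝ φ q w) - G q (Γ q v u) w
      = G' (φ q) (coordSecondDeriv Γ' φ q v u) (fderiv ℝ φ q w) - G q (Γ q u v) w := by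
    intro u v w
    rw [coordSecondDeriv_symm h' hφq (hm hq), h.christoffel_symm q hq]
  -- Koszul's argument: a trilinear expression that is skew in its last two slots (`hX`) and
  -- symmetric in its first two (`hS`) changes sign along a cycle of six exchanges, hence vanishes.
  linarith [hX u v t, hS u t v, hX t u v, hS t v u, hX v t u, hS v u t]

lemma differentiableAt_coordSecondDeriv (hp : p ∈ O) (v w : E) :
    DifferentiableAt ℝ (fun q => coordSecondDeriv Γ' φ q v w) p := by
  have hφp := hφ.contDiffAt (h.isOpen.mem_nhds hp)
  have hd : ∀ v, DifferentiableAt ℝ (fun q => fderiv ℝ φ q v) p := fun v =>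
    (contDiffAt_fderiv_apply hφp v).differentiableAt (by simp)
  exact ((contDiffAt_fderiv_apply (contDiffAt_fderiv_apply hφp w) v).differentiableAt
    (by simp)).add (((DifferentiableAt.fun_comp' (G := E' →L[ℝ] E' →L[ℝ] E') p
      (h'.differentiableAt_christoffel (hm hp))
      (hφp.differentiableAt (by simp))).clm_apply (hd w)).clm_apply (hd v))

/-- Antisymmetrizing the second covariant derivative of $d\varphi(w)$ along `φ` removes the second
and third derivatives of `φ`; what remains is the ambient curvature on the image vectors. -/
lemma fderiv_coordSecondDeriv_sub (hp : p ∈ O) (u v w : E) :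
    (fderiv ℝ (fun q => coordSecondDeriv Γ' φ q v w) p u
        + Γ' (φ p) (coordSecondDeriv Γ' φ p v w) (fderiv ℝ φ p u))
      - (fderiv ℝ (fun q => coordSecondDeriv Γ' φ q u w) p v
        + Γ' (φ p) (coordSecondDeriv Γ' φ p u w) (fderiv ℝ φ p v)) =
      coordCurvature Γ' (φ p) (fderiv ℝ φ p u) (fderiv ℝ φ p v) (fderiv ℝ φ p w) := by
  have hφp := hφ.contDiffAt (h.isOpen.mem_nhds hp)
  have hd : ∀ v, DifferentiableAt ℝ (fun q => fderiv ℝ φ q v) p := fun v =>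
    (contDiffAt_fderiv_apply hφp v).differentiableAt (by simp)
  have hdφ := hφp.differentiableAt (n := ∞) (by simp)
  have hΓ' := h'.differentiableAt_christoffel (hm hp)
  have hc : ∀ u, fderiv ℝ (fun q => Γ' (φ q)) p u = fderiv ℝ Γ' (φ p) (fderiv ℝ φ p u) := by
    intro u
    rw [fderiv_fun_comp (G := E' →L[ℝ] E' →L[ℝ] E') p hΓ' hdφ]
    rfl
  have key : ∀ u v, fderiv ℝ (fun q => coordSecondDeriv Γ' φ q v w) p u =
      fderiv ℝ (fun q => fderiv ℝ (fun q => fderiv ℝ φ q w) q v) p u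
      + (fderiv ℝ Γ' (φ p) (fderiv ℝ φ p u) (fderiv ℝ φ p w) (fderiv ℝ φ p v)
        + Γ' (φ p) (fderiv ℝ (fun q => fderiv ℝ φ q w) p u) (fderiv ℝ φ p v)
        + Γ' (φ p) (fderiv ℝ φ p w) (fderiv ℝ (fun q => fderiv ℝ φ q v) p u)) := by
    intro u v
    have hL : DifferentiableAt ℝ (fun q => Γ' (φ q)) p :=
      DifferentiableAt.fun_comp' (G := E' →L[ℝ] E' →L[ℝ] E') p hΓ' hdφ
    simp only [coordSecondDeriv]
    rw [fderiv_fun_add ((contDiffAt_fderiv_apply (contDiffAt_fderiv_apply hφp w) v).differentiableAt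
      (by simp)) ((hL.clm_apply (hd w)).clm_apply (hd v)), add_apply,
      fderiv_apply_apply_fun hL (hd w) (hd v), hc]
  rw [key, key, fderiv_fderiv_comm (contDiffAt_fderiv_apply hφp w) u v,
    fderiv_fderiv_comm hφp u v]
  simp only [coordCurvature, coordSecondDeriv, map_add, add_apply]
  abel

/-- The Gauss equation. -/
lemma gauss_equation (hp : p ∈ O) (u v w t : E) :
    G' (φ p) (coordCurvature Γ' (φ p) (fderiv ℝ φ p u) (fderiv ℝ φ p v) (fderiv ℝ φ p w))
        (fderiv ℝ φ p t)
      + G' (φ p) (coordSecondDeriv Γ' φ p v w) (coordSecondDeriv Γ' φ p u t)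
      - G' (φ p) (coordSecondDeriv Γ' φ p u w) (coordSecondDeriv Γ' φ p v t) =
    G p (coordCurvature Γ p u v w) t + G p (Γ p w v) (Γ p t u) - G p (Γ p w u) (Γ p t v) := by
  have hφp := hφ.contDiffAt (h.isOpen.mem_nhds hp)
  have hd : ∀ v, DifferentiableAt ℝ (fun q => fderiv ℝ φ q v) p := fun v =>
    (contDiffAt_fderiv_apply hφp v).differentiableAt (by simp)
  -- This differentiates the formula for the tangential part of the second derivative in the
  -- direction `u`; antisymmetrizing in `u`, `v` gives the claim. Full second derivatives stand in
  -- place of the second fundamental form, so the right side keeps the products $g(\Gamma,\Gamma)$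
  -- of their tangential parts.
  have key : ∀ u v,
      G' (φ p) (fderiv ℝ (fun q => coordSecondDeriv Γ' φ q v w) p u
        + Γ' (φ p) (coordSecondDeriv Γ' φ p v w) (fderiv ℝ φ p u)) (fderiv ℝ φ p t)
      + G' (φ p) (coordSecondDeriv Γ' φ p v w) (coordSecondDeriv Γ' φ p u t) =
      G p (Γ p (Γ p w v) u) t + G p (Γ p w v) (Γ p t u) + G p (fderiv ℝ Γ p u w v) t := by
    intro u v
    have hE : (fun q => G' (φ q) (coordSecondDeriv Γ' φ q v w) (fderiv ℝ φ q t)) =ᶠ[𝓝 p]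
        fun q => G q (Γ q w v) t := by
      filter_upwards [h.isOpen.mem_nhds hp] with q hq using
        metric_coordSecondDeriv h h' hφ hm hiso hq v w t
    have h1 := fderiv_pullback_metric h' hφp (hm hp)
      (differentiableAt_coordSecondDeriv h h' hφ hm hiso hp v w) (hd t) u
    rw [hE.fderiv_eq, fderiv_apply_apply_fun (h.differentiableAt_metric hp)
      (h.differentiableAt_christoffel_apply hp w v) (differentiableAt_const t),
      fderiv_apply_apply_const (h.differentiableAt_christoffel hp), h.fderiv_metric p hp] at h1
    simp only [fderiv_fun_const, Pi.zero_apply, zero_apply, map_zero, add_zero] at h1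
    rw [h1]
    rfl
  have h1 := key u v
  have h2 := key v u
  rw [← fderiv_coordSecondDeriv_sub h h' hφ hm hiso hp, map_sub, sub_apply]
  simp only [coordCurvature, map_add, map_sub, add_apply, sub_apply] at h1 h2 ⊢
  linarith

omit hiso in
/-- For a Lagrangian immersion, `g(∇_u dφ(v), J dφ(w))` is symmetric in `v`, `w`. -/
lemma metric_coordSecondDeriv_lagrangian {J : E' → E' →L[ℝ] E'} (hJ : ContDiffOn ℝ ∞ J O')
    (hpar : ∀ q ∈ O', ∀ u w, fderiv ℝ J q u w = J q (Γ' q w u) - Γ' q (J q w) u)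
    (hlag : ∀ q ∈ O, ∀ v w, G' (φ q) (J (φ q) (fderiv ℝ φ q v)) (fderiv ℝ φ q w) = 0)
    (hp : p ∈ O) (u v w : E) :
    G' (φ p) (J (φ p) (coordSecondDeriv Γ' φ p u v)) (fderiv ℝ φ p w)
      + G' (φ p) (J (φ p) (fderiv ℝ φ p v)) (coordSecondDeriv Γ' φ p u w) = 0 := by
  have hφp := hφ.contDiffAt (h.isOpen.mem_nhds hp)
  have hd : ∀ v, DifferentiableAt ℝ (fun q => fderiv ℝ φ q v) p := fun v =>
    (contDiffAt_fderiv_apply hφp v).differentiableAt (by simp)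
  have hdφ := hφp.differentiableAt (n := ∞) (by simp)
  have hJd : DifferentiableAt ℝ J (φ p) :=
    (hJ.contDiffAt (h'.isOpen.mem_nhds (hm hp))).differentiableAt (by simp)
  have hJc : DifferentiableAt ℝ (fun q => J (φ q)) p := hJd.comp p hdφ
  have hE : (fun q => G' (φ q) (J (φ q) (fderiv ℝ φ q v)) (fderiv ℝ φ q w)) =ᶠ[𝓝 p]
      fun _ => 0 := by
    filter_upwards [h.isOpen.mem_nhds hp] with q hq using hlag q hq v w
  have h1 := fderiv_pullback_metric h' hφp (hm hp) (hJc.clm_apply (hd v)) (hd w) u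
  have hc : fderiv ℝ (fun q => J (φ q)) p u = fderiv ℝ J (φ p) (fderiv ℝ φ p u) := by
    rw [fderiv_fun_comp p hJd hdφ]
    rfl
  rw [hE.fderiv_eq, fderiv_apply_fun hJc (hd v), hc, hpar _ (hm hp)] at h1
  simp only [fderiv_fun_const, Pi.zero_apply, zero_apply] at h1
  simp only [coordSecondDeriv, map_add, map_sub, add_apply, sub_apply] at h1 ⊢
  linarith

end Immersion

/-! ### Affine hypersurfaces in coordinates: Gauss and Codazzi equations -/

section Hypersurface

variable {E : Type*} [NormedAddCommGroup E] [NormedSpace ℝ E]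
  {F : Type*} [NormedAddCommGroup F] [NormedSpace ℝ F]
  {G : E → E →L[ℝ] E →L[ℝ] ℝ} {Γ : E → E →L[ℝ] E →L[ℝ] E} {O : Set E} {p : E}
  {φ ξ : E → F} {S : E → E → E}

/-- Uniqueness of the splitting into tangential and transversal parts, by which one vector identity
in the ambient space becomes two equations. -/
lemma eq_and_eq_of_transversal {p : E} {x y : E} {a b : ℝ}
    (hinj : Function.Injective (fderiv ℝ φ p)) (htr : ξ p ∉ range (fderiv ℝ φ p))
    (he : fderiv ℝ φ p x + a • ξ p = fderiv ℝ φ p y + b • ξ p) : x = y ∧ a = b := by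
  have hab : a = b := by
    by_contra hne
    have hne' : a - b ≠ 0 := sub_ne_zero.2 hne
    refine htr ⟨(a - b)⁻¹ • (y - x), ?_⟩
    have : (a - b) • ξ p = fderiv ℝ φ p (y - x) := by
      rw [map_sub, sub_smul, sub_eq_sub_iff_add_eq_add, add_comm, he, add_comm]
    rw [map_smul, ← this, smul_smul, inv_mul_cancel₀ hne', one_smul]
  subst hab
  exact ⟨hinj (add_right_cancel he), rfl⟩

variable (hO : IsOpen O) (hφ : ContDiffOn ℝ ∞ φ O) (hG : DifferentiableOn ℝ G O)
  (hΓ : DifferentiableOn ℝ Γ O) (hξ : DifferentiableOn ℝ ξ O)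
  (hinj : ∀ q ∈ O, Function.Injective (fderiv ℝ φ q))
  (htr : ∀ q ∈ O, ξ q ∉ range (fderiv ℝ φ q))
  (hgauss : ∀ q ∈ O, ∀ u w,
    fderiv ℝ (fun q => fderiv ℝ φ q w) q u = fderiv ℝ φ q (Γ q w u) + G q u w • ξ q)
  (hwein : ∀ q ∈ O, ∀ u, fderiv ℝ ξ q u = - fderiv ℝ φ q (S q u))

include hO hφ hG hΓ hξ hinj htr hgauss

/-- Torsion-freeness is not assumed of the induced connection; it is the tangential part of the
symmetry of second derivatives of `φ`. -/
lemma hypersurface_christoffel_symm (hp : p ∈ O) (u v : E) : Γ p u v = Γ p v u := by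
  have h1 := fderiv_fderiv_comm (hφ.contDiffAt (hO.mem_nhds hp)) u v
  rw [hgauss p hp, hgauss p hp] at h1
  exact (eq_and_eq_of_transversal (hinj p hp) (htr p hp) h1).1.symm

include hwein

/-- The second derivatives of $d\varphi(w)$ commute. After the formulas of Gauss and Weingarten are
inserted, the tangential part is the Gauss equation and the transversal part the Codazzi equation.
`S` is never differentiated, so it may be any function. -/
lemma hypersurface_structure (hp : p ∈ O) (u v w : E) :
    coordCurvature Γ p u v w = G p v w • S p u - G p u w • S p v ∧
    G p u (Γ p w v) + fderiv ℝ G p u v w = G p v (Γ p w u) + fderiv ℝ G p v u w := by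
  have hn := hO.mem_nhds hp
  have hφp := hφ.contDiffAt hn
  have hΓp := (hΓ p hp).differentiableAt hn
  have hGp := (hG p hp).differentiableAt hn
  have hξp := (hξ p hp).differentiableAt hn
  have hd := differentiableAt_fderiv hφp
  have key : ∀ u v, fderiv ℝ (fun q => fderiv ℝ (fun q => fderiv ℝ φ q w) q v) p u =
      fderiv ℝ φ p (Γ p (Γ p w v) u + fderiv ℝ Γ p u w v - G p v w • S p u)
      + (G p u (Γ p w v) + fderiv ℝ G p u v w) • ξ p := by
    intro u v
    have hE : (fun q => fderiv ℝ (fun q => fderiv ℝ φ q w) q v) =ᶠ[𝓝 p]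
        (fun q => fderiv ℝ φ q (Γ q w v)) + fun q => G q v w • ξ q := by
      filter_upwards [hn] with q hq using hgauss q hq v w
    have hX : DifferentiableAt ℝ (fun q => Γ q w v) p :=
      (hΓp.clm_apply (differentiableAt_const w)).clm_apply (differentiableAt_const v)
    have hY : DifferentiableAt ℝ (fun q => G q v w) p :=
      (hGp.clm_apply (differentiableAt_const v)).clm_apply (differentiableAt_const w)
    rw [hE.fderiv_eq, fderiv_add (hd.clm_apply hX) (hY.fun_smul hξp), add_apply,
      fderiv_apply_fun hd hX, fderiv_fun_smul hY hξp, ← fderiv_apply_const hd, hgauss p hp]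
    simp only [add_apply, smul_apply, ContinuousLinearMap.smulRight_apply,
      fderiv_apply_apply_const hGp, fderiv_apply_apply_const hΓp, hwein p hp, map_add, map_sub,
      map_smul, add_smul, smul_neg]
    abel
  have h1 := fderiv_fderiv_comm (contDiffAt_fderiv_apply hφp w) u v
  rw [key, key] at h1
  obtain ⟨h2, h3⟩ := eq_and_eq_of_transversal (hinj p hp) (htr p hp) h1
  refine ⟨?_, h3⟩
  rw [← sub_eq_zero] at h2 ⊢
  rw [← h2, coordCurvature]
  abel

lemma hypersurface_codazzi (hp : p ∈ O) (u v w : E) :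
    coordMetricDeriv G Γ p u v w = coordMetricDeriv G Γ p v u w := by
  have h1 := (hypersurface_structure hO hφ hG hΓ hξ hinj htr hgauss hwein hp u v w).2
  have h2 := hypersurface_christoffel_symm hO hφ hG hΓ hξ hinj htr hgauss hp u v
  simp only [coordMetricDeriv]
  rw [h2]
  linarith

end Hypersurface

/-! ### Trace inequality for symmetric cubic forms -/

section CubicForm

/-- For a totally symmetric cubic form with trace `e`, `3 ‖e‖² ≤ (n + 2) ‖a‖²`. -/
lemma three_mul_sum_trace_sq_le {ι : Type*} [Fintype ι] (a : ι → ι → ι → ℝ)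
    (h12 : ∀ i j k, a i j k = a j i k) (h23 : ∀ i j k, a i j k = a i k j) :
    3 * ∑ k, (∑ i, a i i k) ^ 2 ≤ (Fintype.card ι + 2) * ∑ i, ∑ j, ∑ k, a i j k ^ 2 := by
  classical
  set e : ι → ℝ := fun k => ∑ i, a i i k with he
  set m : ℝ := Fintype.card ι + 2 with hm
  have hm0 : 0 < m := by positivity
  let d : ι → ι → ℝ := fun i j => if i = j then 1 else 0
  -- The square norm of $m$ times the trace-free part of `a`, with $m=n+2$ because the symmetrized
  -- product of $e$ and $\delta$ has trace $(n+2)e$. It expands to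
  -- $m^2\|a\|^2-6m\|e\|^2+(3n+6)\|e\|^2=m(m\|a\|^2-3\|e\|^2)$.
  have h0 : 0 ≤ ∑ i, ∑ j, ∑ k, (m * a i j k - (e i * d j k + e j * d i k + e k * d i j)) ^ 2 := by
    positivity
  have hexp : ∀ i j k, (m * a i j k - (e i * d j k + e j * d i k + e k * d i j)) ^ 2 =
      m ^ 2 * a i j k ^ 2 - 2 * m * (e i * (a i j k * d j k)) - 2 * m * (e j * (a i j k * d i k))
      - 2 * m * (e k * (a i j k * d i j))
      + (e i ^ 2 * (d j k * d j k) + e j ^ 2 * (d i k * d i k) + e k ^ 2 * (d i j * d i j)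
        + 2 * (e i * (e j * (d j k * d i k))) + 2 * (e i * (e k * (d j k * d i j)))
        + 2 * (e j * (e k * (d i k * d i j)))) := by
    intro i j k; ring
  have hT : ∀ i, ∑ j, a i j j = e i := by
    intro i
    rw [he]
    exact Finset.sum_congr rfl fun j _ => by rw [h12, h23]
  have s1 : ∑ i, ∑ j, ∑ k, e i * (a i j k * d j k) = ∑ k, e k ^ 2 := by
    simp only [d, mul_ite, mul_one, mul_zero, Finset.sum_ite_eq, Finset.mem_univ, if_true,
      ← Finset.mul_sum, hT, sq]
  have s2 : ∑ i, ∑ j, ∑ k, e j * (a i j k * d i k) = ∑ k, e k ^ 2 := by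
    rw [Finset.sum_comm]
    simp only [d, mul_ite, mul_one, mul_zero, Finset.sum_ite_eq, Finset.mem_univ, if_true,
      ← Finset.mul_sum, sq]
    refine Finset.sum_congr rfl fun i _ => ?_
    rw [← hT i]
    congr 1
    exact Finset.sum_congr rfl fun j _ => h12 _ _ _
  have s3 : ∑ i, ∑ j, ∑ k, e k * (a i j k * d i j) = ∑ k, e k ^ 2 := by
    have : ∀ i, ∑ j, ∑ k, e k * (a i j k * d i j) = ∑ k, e k * a i i k := by
      intro i
      rw [Finset.sum_comm]
      simp only [d, mul_ite, mul_one, mul_zero, Finset.sum_ite_eq, Finset.mem_univ, if_true]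
    simp only [this]
    rw [Finset.sum_comm]
    simp only [← Finset.mul_sum, sq]
    rfl
  have q1 : ∑ i, ∑ j, ∑ k, e i ^ 2 * (d j k * d j k) = Fintype.card ι * ∑ k, e k ^ 2 := by
    simp [d, Finset.mul_sum]
  have q2 : ∑ i, ∑ j, ∑ k, e j ^ 2 * (d i k * d i k) = Fintype.card ι * ∑ k, e k ^ 2 := by
    simp [d]
  have q3 : ∑ i, ∑ j, ∑ k, e k ^ 2 * (d i j * d i j) = Fintype.card ι * ∑ k, e k ^ 2 := by
    have : ∀ i, ∑ j, ∑ k, e k ^ 2 * (d i j * d i j) = ∑ k, e k ^ 2 := by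
      intro i
      rw [Finset.sum_comm]
      simp [d]
    simp [this]
  have q4 : ∑ i, ∑ j, ∑ k, e i * (e j * (d j k * d i k)) = ∑ k, e k ^ 2 := by
    simp [d, sq]
  have q5 : ∑ i, ∑ j, ∑ k, e i * (e k * (d j k * d i j)) = ∑ k, e k ^ 2 := by
    simp [d, sq]
  have q6 : ∑ i, ∑ j, ∑ k, e j * (e k * (d i k * d i j)) = ∑ k, e k ^ 2 := by
    simp [d, sq]
  simp only [hexp, Finset.sum_add_distrib, Finset.sum_sub_distrib, ← Finset.mul_sum] at h0
  simp only [Finset.mul_sum] at h0 s1 s2 s3 q1 q2 q3 q4 q5 q6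
  simp only [← Finset.mul_sum] at h0 s1 s2 s3 q1 q2 q3 q4 q5 q6
  rw [s1, s2, s3, q1, q2, q3, q4, q5, q6] at h0
  have h1 : 0 ≤ m * (m * ∑ i, ∑ j, ∑ k, a i j k ^ 2 - 3 * ∑ k, e k ^ 2) := by
    have : (Fintype.card ι : ℝ) = m - 2 := by rw [hm]; ring
    rw [this] at h0
    linarith
  have := nonneg_of_mul_nonneg_right h1 hm0
  linarith

end CubicForm

/-! ### Polarization of the holomorphic sectional curvature -/

section SpaceForm

variable {V : Type*} [AddCommGroup V] {R : V → V → V → V → ℝ} {J : V → V}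

/-- If `R` is a curvature-like tensor that is invariant under the complex structure `J`, its
holomorphic sectional curvatures determine the sectional curvature of a plane spanned by `x`, `y`
for which `x`, `y`, `J y` are orthonormal. -/
lemma four_mul_sectional_eq (add₁ : ∀ x y v w t, R (x + y) v w t = R x v w t + R y v w t)
    (a12 : ∀ u v w t, R v u w t = - R u v w t) (a34 : ∀ u v w t, R u v t w = - R u v w t)
    (bianchi : ∀ u v w t, R u v w t + R v w u t + R w u v t = 0)
    (inv : ∀ u v w t, R u v (J w) (J t) = R u v w t)
    (Jadd : ∀ x y, J (x + y) = J x + J y) (Jsq : ∀ x, J (J x) = - x) {κ : ℝ} {x y : V}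
    (hx : R x (J x) (J x) x = κ) (hy : R y (J y) (J y) y = κ)
    (hxy : R (x + y) (J (x + y)) (J (x + y)) (x + y) = 4 * κ)
    (hxy' : R (x + -y) (J (x + -y)) (J (x + -y)) (x + -y) = 4 * κ)
    (hxJ : R (x + J y) (J (x + J y)) (J (x + J y)) (x + J y) = 4 * κ)
    (hxJ' : R (x + -J y) (J (x + -J y)) (J (x + -J y)) (x + -J y) = 4 * κ) :
    4 * R x y y x = κ := by
  have pair : ∀ u v w t, R u v w t = R w t u v := by
    intro u v w t
    linarith [bianchi u v w t, bianchi v w t u, bianchi w t u v, bianchi t u v w,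
      a12 u v w t, a34 u v w t, a12 v w u t, a34 v w u t, a12 w u v t, a34 w u v t,
      a12 v w t u, a34 v w t u, a12 w t v u, a34 w t v u, a12 t v w u, a34 t v w u,
      a12 w t u v, a34 w t u v, a12 t u w v, a34 t u w v, a12 u w t v, a34 u w t v,
      a12 t u v w, a34 t u v w, a12 u v t w, a34 u v t w, a12 v t u w, a34 v t u w,
      a34 u w v t, a34 v t w u, a34 u t v w, a34 v w t u, a34 t v u w, a34 w t v u, a34 u v t w]
  have add₂ : ∀ x y v w t, R v (x + y) w t = R v x w t + R v y w t := by
    intro x y v w t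
    linarith [a12 v (x + y) w t, add₁ x y v w t, a12 v x w t, a12 v y w t]
  have add₃ : ∀ x y u v t, R u v (x + y) t = R u v x t + R u v y t := by
    intro x y u v t
    rw [pair, add₁, pair x, pair y]
  have add₄ : ∀ x y u v w, R u v w (x + y) = R u v w x + R u v w y := by
    intro x y u v w
    rw [pair, add₂, pair _ x, pair _ y]
  have zero₁ : ∀ v w t, R 0 v w t = 0 := by
    intro v w t
    have := add₁ 0 0 v w t
    rw [add_zero] at this
    linarith
  have neg₁ : ∀ x v w t, R (-x) v w t = - R x v w t := by
    intro x v w t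
    have := add₁ x (-x) v w t
    rw [add_neg_cancel, zero₁] at this
    linarith
  have neg₂ : ∀ x v w t, R v (-x) w t = - R v x w t := by
    intro x v w t
    rw [a12, neg₁, a12, neg_neg]
  have neg₃ : ∀ x u v t, R u v (-x) t = - R u v x t := by
    intro x u v t
    rw [pair, neg₁, pair]
  have neg₄ : ∀ x u v w, R u v w (-x) = - R u v w x := by
    intro x u v w
    rw [pair, neg₂, pair]
  have Jneg : ∀ x, J (-x) = - J x := by
    intro x
    rw [← Jsq x, Jsq (J x)]
  have inv' : ∀ u v w t, R (J u) (J v) w t = R u v w t := by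
    intro u v w t
    rw [pair, inv, pair]
  -- Adding the hypotheses for $x+y$ and $x-y$ kills the terms odd in $y$. By Bianchi and
  -- $J$-invariance the remaining mixed terms reduce to $R(x,y,y,x)$ and $R(x,Jy,Jy,x)$.
  have main : ∀ y : V, R y (J y) (J y) y = κ →
      R (x + y) (J (x + y)) (J (x + y)) (x + y) = 4 * κ →
      R (x + -y) (J (x + -y)) (J (x + -y)) (x + -y) = 4 * κ →
      2 * R x y y x + 6 * R x (J y) (J y) x = 2 * κ := by
    intro y hy h1 h2
    have t1 : R x (J y) (J x) y = R x (J y) (J y) x := by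
      rw [← inv x (J y) (J x) y, Jsq, neg₃, a34, neg_neg]
    have t2 : R y (J x) (J y) x = R x (J y) (J y) x := by
      rw [pair, a12, a34, neg_neg, t1]
    have t3 : R y (J x) (J x) y = R x (J y) (J y) x := by
      rw [← inv y, Jsq, ← inv', Jsq, neg₂, neg₃, neg_neg, a12, a34, neg_neg]
    have t4 : R x (J x) (J y) y = R x y y x + R x (J y) (J y) x := by
      have b := bianchi x (J x) (J y) y
      rw [inv', a34 x y y x, a12 x (J y), t1] at b
      linarith
    have t5 : R y (J y) (J x) x = R x y y x + R x (J y) (J y) x := by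
      rw [pair, a12, a34, neg_neg, t4]
    simp only [Jadd, Jneg, add₁, add₂, add₃, add₄, neg₁, neg₂, neg₃, neg₄, neg_neg] at h1 h2
    linarith
  have hJy : R (J y) (J (J y)) (J (J y)) (J y) = κ := by
    rw [inv', inv, hy]
  -- Passing from $y$ to $Jy$ exchanges the two unknowns, so $2a+6b=2\kappa$ and $6a+2b=2\kappa$,
  -- whence $a=b=\kappa/4$.
  have m1 := main y hy hxy hxy'
  have m2 := main (J y) hJy hxJ hxJ'
  simp only [Jsq, neg₂, neg₃, neg_neg] at m2
  linarith

end SpaceForm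

/-! ### From coordinates back to the manifold: scalar curvature and difference tensor -/

section StatisticalManifold

variable {E : Type*} [NormedAddCommGroup E] [NormedSpace ℝ E] [FiniteDimensional ℝ E]
  {H : Type*} [TopologicalSpace H] {I : ModelWithCorners ℝ E H} [I.Boundaryless]
  {M : Type*} [TopologicalSpace M] [ChartedSpace H M] [IsManifold I ∞ M]
  [RiemannianBundle (fun x : M => TangentSpace I x)]

lemma sum_inner_sq (x : M) (w : TangentSpace I x) :
    ∑ k, (inner ℝ w (stdOrthonormalBasis ℝ (TangentSpace I x) k) : ℝ) ^ 2 = inner ℝ w w := by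
  rw [← (stdOrthonormalBasis ℝ (TangentSpace I x)).sum_inner_mul_inner w w]
  exact Finset.sum_congr rfl fun k _ => by rw [sq, real_inner_comm w]

lemma cubicNormSq_eq (K : ∀ x : M, TangentSpace I x → TangentSpace I x → TangentSpace I x)
    (x : M) : cubicNormSq K x = ∑ i, ∑ j, inner ℝ
      (K x (stdOrthonormalBasis ℝ (TangentSpace I x) i) (stdOrthonormalBasis ℝ (TangentSpace I x) j))
      (K x (stdOrthonormalBasis ℝ (TangentSpace I x) i)
        (stdOrthonormalBasis ℝ (TangentSpace I x) j)) := by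
  simp only [cubicNormSq, cubicForm, sum_inner_sq]

lemma norm_traceField_sq (K : ∀ x : M, TangentSpace I x → TangentSpace I x → TangentSpace I x)
    (x : M) : ‖traceField K x‖ ^ 2 = ∑ j, ∑ i, inner ℝ
      (K x (stdOrthonormalBasis ℝ (TangentSpace I x) i) (stdOrthonormalBasis ℝ (TangentSpace I x) i))
      (K x (stdOrthonormalBasis ℝ (TangentSpace I x) j)
        (stdOrthonormalBasis ℝ (TangentSpace I x) j)) := by
  rw [← real_inner_self_eq_norm_sq, traceField, inner_sum]
  simp only [sum_inner]

lemma three_mul_norm_traceField_sq_le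
    (K : ∀ x : M, TangentSpace I x → TangentSpace I x → TangentSpace I x) (x : M)
    (h12 : ∀ u v, K x u v = K x v u)
    (h13 : ∀ u v w, cubicForm K x u v w = cubicForm K x w v u) :
    3 * ‖traceField K x‖ ^ 2 ≤ (Module.finrank ℝ E + 2) * cubicNormSq K x := by
  have h := three_mul_sum_trace_sq_le (fun i j k =>
    cubicForm K x (stdOrthonormalBasis ℝ (TangentSpace I x) i)
      (stdOrthonormalBasis ℝ (TangentSpace I x) j) (stdOrthonormalBasis ℝ (TangentSpace I x) k))
    (fun i j k => by rw [cubicForm, h12]; rfl)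
    (fun i j k => by rw [cubicForm, h12, ← cubicForm, h13, cubicForm, h12]; rfl)
  rw [Fintype.card_fin] at h
  rw [← real_inner_self_eq_norm_sq, ← sum_inner_sq]
  simp only [cubicForm, ← sum_inner] at h
  exact h

variable [IsContMDiffRiemannianBundle I ∞ E (fun x : M => TangentSpace I x)] [T2Space M]

lemma IsLeviCivita.isCoordLeviCivita {cov : AffineConnection I M} (h : IsLeviCivita cov) (x₀ : M) :
    IsCoordLeviCivita (StatGeom.metric I x₀) (christoffel cov x₀) (extChartAt I x₀).target where
  isOpen := isOpen_extChartAt_target x₀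
  contDiffOn_metric := StatGeom.contDiffOn_metric x₀
  contDiffOn_christoffel := contDiffOn_christoffel h.smooth x₀
  metric_symm := StatGeom.metric_symm
  christoffel_symm q hq := christoffel_symm h.torsion_free hq
  fderiv_metric q hq u v w := by
    have hy := (extChartAt I x₀).map_target hq
    have h1 := h.metric _ (frame x₀ u _) (frame x₀ v) (frame x₀ w) (mdifferentiableAt_frame hy v)
      (mdifferentiableAt_frame hy w)
    rw [metricDeriv_frame cov hq] at h1
    linarith

lemma IsStatistical.coordMetricDeriv_symm {cov : AffineConnection I M} (h : IsStatistical cov)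
    {x₀ : M} {q : E} (hq : q ∈ (extChartAt I x₀).target) (u v w : E) :
    coordMetricDeriv (metric I x₀) (christoffel cov x₀) q u v w =
      coordMetricDeriv (metric I x₀) (christoffel cov x₀) q v u w := by
  have hy := (extChartAt I x₀).map_target hq
  have h1 := (h.cubic_symm _ (frame x₀ u) (frame x₀ v) (frame x₀ w) (mdifferentiableAt_frame hy u)
    (mdifferentiableAt_frame hy v) (mdifferentiableAt_frame hy w)).1
  rwa [metricDeriv_frame cov hq, metricDeriv_frame cov hq] at h1

/-- The difference of two connections is tensorial, so it may be evaluated on the coordinate field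
through `v`, where only Christoffel symbols remain. -/
lemma coord_differenceTensor (cov cov' : AffineConnection I M) {x₀ : M} (u v : TangentSpace I x₀) :
    coord I x₀ x₀ (differenceTensor cov cov' x₀ u v) =
      (christoffel cov x₀ - christoffel cov' x₀) (extChartAt I x₀ x₀)
        (coord I x₀ x₀ v) (coord I x₀ x₀ u) := by
  have hx := mem_extChartAt_source (I := I) x₀
  have h := IsCovariantDerivativeOn.difference_apply cov.isCovariantDerivativeOnUniv
    cov'.isCovariantDerivativeOnUniv (x := x₀)
    (hσ := mdifferentiableAt_frame hx (coord I x₀ x₀ v))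
  rw [frame_coord hx] at h
  rw [differenceTensor, CovariantDerivative.difference, h, sub_apply, map_sub]
  exact congrArg₂ (· - ·) (coord_cov_frame cov hx _ u) (coord_cov_frame cov' hx _ u)

lemma scalarCurvature_eq {cov : AffineConnection I M}
    (hcov : cov.ContMDiffCovariantDerivative ∞) (x₀ : M) :
    scalarCurvature cov x₀ = ∑ j, ∑ i, metric I x₀ (extChartAt I x₀ x₀)
      (coordCurvature (christoffel cov x₀) (extChartAt I x₀ x₀)
        (coord I x₀ x₀ (stdOrthonormalBasis ℝ (TangentSpace I x₀) i))
        (coord I x₀ x₀ (stdOrthonormalBasis ℝ (TangentSpace I x₀) j))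
        (coord I x₀ x₀ (stdOrthonormalBasis ℝ (TangentSpace I x₀) j)))
      (coord I x₀ x₀ (stdOrthonormalBasis ℝ (TangentSpace I x₀) i)) := by
  simp only [scalarCurvature, ricci, ← coord_curvature hcov,
    metric_coord (mem_extChartAt_source (I := I) x₀)]

/-- The scalar curvature of a connection whose Christoffel symbols and covariant derivative of the
metric are symmetric near `x₀`, and the symmetry of its cubic form at `x₀`. -/
lemma scalarCurvature_sub_of_coord_symm {nabla nablaHat : AffineConnection I M}
    (hHat : IsLeviCivita nablaHat) (hs : nabla.ContMDiffCovariantDerivative ∞) (x₀ : M)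
    (hsymm : ∀ q ∈ (extChartAt I x₀).target, ∀ v w,
      christoffel nabla x₀ q v w = christoffel nabla x₀ q w v)
    (hcubic : ∀ q ∈ (extChartAt I x₀).target, ∀ u v w,
      coordMetricDeriv (metric I x₀) (christoffel nabla x₀) q u v w =
        coordMetricDeriv (metric I x₀) (christoffel nabla x₀) q v u w) :
    scalarCurvature nablaHat x₀ - scalarCurvature nabla x₀ =
      cubicNormSq (differenceTensor nabla nablaHat) x₀
        - ‖traceField (differenceTensor nabla nablaHat) x₀‖ ^ 2 ∧
    3 * ‖traceField (differenceTensor nabla nablaHat) x₀‖ ^ 2 ≤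
      (Module.finrank ℝ E + 2) * cubicNormSq (differenceTensor nabla nablaHat) x₀ := by
  have hx := mem_extChartAt_source (I := I) x₀
  have hp := (extChartAt I x₀).map_source hx
  have hL := hHat.isCoordLeviCivita x₀
  have hD : ∀ v w, (christoffel nabla x₀ - christoffel nablaHat x₀) (extChartAt I x₀ x₀) v w =
      (christoffel nabla x₀ - christoffel nablaHat x₀) (extChartAt I x₀ x₀) w v := by
    intro v w
    simp only [Pi.sub_apply, sub_apply, hsymm _ hp v w, hL.christoffel_symm _ hp v w]
  refine ⟨?_, three_mul_norm_traceField_sq_le _ x₀ ?_ ?_⟩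
  · rw [scalarCurvature_eq hHat.smooth, scalarCurvature_eq hs,
      hL.sum_metric_coordCurvature_sub hp (differentiableAt_christoffel hs hp) hsymm hcubic,
      cubicNormSq_eq, norm_traceField_sq]
    simp only [← coord_differenceTensor, metric_coord hx]
  · intro u v
    rw [← frame_coord hx (differenceTensor nabla nablaHat x₀ u v), coord_differenceTensor, hD,
      ← coord_differenceTensor, frame_coord hx]
  · intro u v w
    simp only [cubicForm, ← metric_coord hx, coord_differenceTensor]
    rw [hD, hL.cubic_symm hp (hsymm _ hp) (hcubic _ hp), hD]

end StatisticalManifold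

/-! ### The two numerical forms of the trace inequality -/

section Inequalities

lemma neg_mul_le_sub_of_three_mul_le {n a e : ℝ} (h : 3 * e ≤ (n + 2) * a) :
    -((n - 1) / 3) * a ≤ a - e := by
  linarith

lemma neg_div_mul_le_sub_of_three_mul_le {n a e : ℝ} (hn : 0 ≤ n) (h : 3 * e ≤ (n + 2) * a) :
    -((n - 1) / (n + 2)) * e ≤ a - e := by
  have h2 : 0 < n + 2 := by linarith
  have : 3 * e / (n + 2) ≤ a := by rw [div_le_iff₀ h2]; linarith
  have h3 : -((n - 1) / (n + 2)) * e = 3 * e / (n + 2) - e := by field_simp; ring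
  linarith

end Inequalities

/-! ### Statistical structures and equiaffine hypersurfaces on manifolds -/

section Statistical

variable {E : Type*} [NormedAddCommGroup E] [NormedSpace ℝ E] [FiniteDimensional ℝ E]
  {H : Type*} [TopologicalSpace H] {I : ModelWithCorners ℝ E H} [I.Boundaryless]
  {M : Type*} [TopologicalSpace M] [ChartedSpace H M] [IsManifold I ∞ M]
  [RiemannianBundle (fun x : M => TangentSpace I x)]

/-- Each ordered pair of distinct basis vectors contributes 1 and the diagonal contributes 0. -/
lemma sum_inner_R0 (x : M) :
    ∑ j, ∑ i, (inner ℝ (R0 (I := I) x (stdOrthonormalBasis ℝ (TangentSpace I x) i)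
      (stdOrthonormalBasis ℝ (TangentSpace I x) j) (stdOrthonormalBasis ℝ (TangentSpace I x) j))
      (stdOrthonormalBasis ℝ (TangentSpace I x) i) : ℝ) =
    Module.finrank ℝ E * (Module.finrank ℝ E - 1) := by
  set b := stdOrthonormalBasis ℝ (TangentSpace I x)
  have h : ∀ i j, (inner ℝ (R0 (I := I) x (b i) (b j) (b j)) (b i) : ℝ) =
      1 - if i = j then 1 else 0 := by
    intro i j
    rw [R0, inner_sub_left, real_inner_smul_left, real_inner_smul_left, real_inner_comm (b i) (b j),
      real_inner_self_eq_norm_sq, real_inner_self_eq_norm_sq, b.norm_eq_one, b.norm_eq_one,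
      orthonormal_iff_ite.1 b.orthonormal]
    split_ifs <;> simp
  simp only [h, Finset.sum_sub_distrib, Finset.sum_ite_eq', Finset.mem_univ, if_true]
  simp only [Finset.sum_const, Finset.card_univ, Fintype.card_fin, nsmul_eq_mul, mul_one]
  have : Module.finrank ℝ (TangentSpace I x) = Module.finrank ℝ E := rfl
  rw [this]
  ring

lemma scalarCurvature_of_curvature_eq {cov : AffineConnection I M} {x : M} {κ : ℝ}
    (h : ∀ u v w, curvature cov x u v w = κ • R0 x u v w) :
    scalarCurvature cov x = κ * (Module.finrank ℝ E * (Module.finrank ℝ E - 1)) := by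
  simp only [scalarCurvature, ricci, h, real_inner_smul_left, ← Finset.mul_sum]
  rw [sum_inner_R0]

variable [IsContMDiffRiemannianBundle I ∞ E (fun x : M => TangentSpace I x)] [T2Space M]

lemma IsStatistical.scalarCurvature_sub {nabla nablaHat : AffineConnection I M}
    (h : IsStatistical nabla) (hHat : IsLeviCivita nablaHat) (x : M) :
    scalarCurvature nablaHat x - scalarCurvature nabla x =
      cubicNormSq (differenceTensor nabla nablaHat) x
        - ‖traceField (differenceTensor nabla nablaHat) x‖ ^ 2 ∧
    3 * ‖traceField (differenceTensor nabla nablaHat) x‖ ^ 2 ≤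
      (Module.finrank ℝ E + 2) * cubicNormSq (differenceTensor nabla nablaHat) x :=
  scalarCurvature_sub_of_coord_symm hHat h.smooth x
    (fun _ hq => christoffel_symm h.torsion_free hq) (fun _ hq => h.coordMetricDeriv_symm hq)

variable {F : Type*} [NormedAddCommGroup F] [NormedSpace ℝ F] {f ξ : M → F}
  {cov : AffineConnection I M} {S : ∀ x : M, TangentSpace I x →L[ℝ] TangentSpace I x}

namespace IsEquiaffineHypersurface

section

variable (h : IsEquiaffineHypersurface f ξ cov S) {x₀ : M} {q : E}
  (hq : q ∈ (extChartAt I x₀).target)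

include h hq

lemma contDiffAt_comp_symm : ContDiffAt ℝ ∞ (f ∘ (extChartAt I x₀).symm) q :=
  StatGeom.contDiffAt_comp_symm hq h.smooth_f.contMDiffAt

lemma fderiv_eq (v : E) : fderiv ℝ (f ∘ (extChartAt I x₀).symm) q v =
    mvfderiv I f ((extChartAt I x₀).symm q) (frame x₀ v _) := by
  rw [mvfderiv_frame ((extChartAt I x₀).map_target hq) (h.smooth_f.mdifferentiableAt (by simp)),
    (extChartAt I x₀).right_inv hq]

lemma injective_fderiv : Function.Injective (fderiv ℝ (f ∘ (extChartAt I x₀).symm) q) := by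
  intro v w hvw
  have hy := (extChartAt I x₀).map_target hq
  rw [h.fderiv_eq hq, h.fderiv_eq hq] at hvw
  rw [← coord_frame (I := I) hy v, h.immersion _ hvw, coord_frame hy]

lemma notMem_range_fderiv : (ξ ∘ (extChartAt I x₀).symm) q ∉
    range (fderiv ℝ (f ∘ (extChartAt I x₀).symm) q) := by
  rintro ⟨v, hv⟩
  exact h.transversal _ ⟨_, (h.fderiv_eq hq v).symm.trans hv⟩

lemma fderiv_fderiv (u w : E) :
    fderiv ℝ (fun q => fderiv ℝ (f ∘ (extChartAt I x₀).symm) q w) q u =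
      fderiv ℝ (f ∘ (extChartAt I x₀).symm) q (christoffel cov x₀ q w u)
        + metric I x₀ q u w • (ξ ∘ (extChartAt I x₀).symm) q := by
  have hy := (extChartAt I x₀).map_target hq
  have hn := (isOpen_extChartAt_source (I := I) x₀).mem_nhds hy
  have e := (extChartAt I x₀).right_inv hq
  have hd : DifferentiableAt ℝ (fun q => fderiv ℝ (f ∘ (extChartAt I x₀).symm) q w)
      (extChartAt I x₀ ((extChartAt I x₀).symm q)) := by
    rw [e]
    exact (contDiffAt_fderiv_apply (h.contDiffAt_comp_symm hq) w).differentiableAt (by simp)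
  have hE : (fun z => mvfderiv I f z (frame x₀ w z)) =ᶠ[𝓝 ((extChartAt I x₀).symm q)]
      (fun q => fderiv ℝ (f ∘ (extChartAt I x₀).symm) q w) ∘ extChartAt I x₀ := by
    filter_upwards [hn] with z hz
    exact mvfderiv_frame hz (h.smooth_f.mdifferentiableAt (by simp)) w
  have hm : MDifferentiableAt I 𝓘(ℝ, F) (fun z => mvfderiv I f z (frame x₀ w z))
      ((extChartAt I x₀).symm q) :=
    (hd.mdifferentiableAt.comp _ (mdifferentiableAt_extChartAt
      (by rwa [extChartAt_source] at hy))).congr_of_eventuallyEq hE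
  have hE' : (fun z => mvfderiv I f z (frame x₀ w z)) ∘ (extChartAt I x₀).symm =ᶠ[𝓝 q]
      fun q => fderiv ℝ (f ∘ (extChartAt I x₀).symm) q w := by
    filter_upwards [(isOpen_extChartAt_target (I := I) x₀).mem_nhds hq] with z hz
    exact (h.fderiv_eq hz w).symm
  have key := h.gauss _ (frame x₀ u _) (frame x₀ w) (mdifferentiableAt_frame hy w)
  rw [mvfderiv_frame hy hm, e, hE'.fderiv_eq, cov_frame cov hy, ← h.fderiv_eq hq,
    ← metric_extChartAt hy] at key
  simp only [e] at key
  exact key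

lemma fderiv_xi (u : E) :
    fderiv ℝ (ξ ∘ (extChartAt I x₀).symm) q u = - fderiv ℝ (f ∘ (extChartAt I x₀).symm) q
      (coord I x₀ _ (S ((extChartAt I x₀).symm q) (frame x₀ u _))) := by
  have hy := (extChartAt I x₀).map_target hq
  have key := h.weingarten _ (frame x₀ u ((extChartAt I x₀).symm q))
  rw [mvfderiv_frame hy (h.smooth_xi.mdifferentiableAt (by simp)),
    (extChartAt I x₀).right_inv hq] at key
  rw [key, h.fderiv_eq hq, frame_coord hy]

lemma christoffel_symm (v w : E) : christoffel cov x₀ q v w = christoffel cov x₀ q w v :=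
  hypersurface_christoffel_symm (isOpen_extChartAt_target x₀)
    (fun _ hq => (h.contDiffAt_comp_symm hq).contDiffWithinAt)
    (fun _ hq => (differentiableAt_metric hq).differentiableWithinAt)
    (fun _ hq => (differentiableAt_christoffel h.smooth hq).differentiableWithinAt)
    (fun _ hq => ((StatGeom.contDiffAt_comp_symm hq
      h.smooth_xi.contMDiffAt).differentiableAt (by simp)).differentiableWithinAt)
    (fun _ hq => h.injective_fderiv hq) (fun _ hq => h.notMem_range_fderiv hq)
    (fun _ hq => h.fderiv_fderiv hq) hq v w

lemma coordMetricDeriv_symm (u v w : E) :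
    coordMetricDeriv (metric I x₀) (christoffel cov x₀) q u v w =
      coordMetricDeriv (metric I x₀) (christoffel cov x₀) q v u w :=
  hypersurface_codazzi (isOpen_extChartAt_target x₀)
    (fun _ hq => (h.contDiffAt_comp_symm hq).contDiffWithinAt)
    (fun _ hq => (differentiableAt_metric hq).differentiableWithinAt)
    (fun _ hq => (differentiableAt_christoffel h.smooth hq).differentiableWithinAt)
    (fun _ hq => ((StatGeom.contDiffAt_comp_symm hq
      h.smooth_xi.contMDiffAt).differentiableAt (by simp)).differentiableWithinAt)
    (fun _ hq => h.injective_fderiv hq) (fun _ hq => h.notMem_range_fderiv hq)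
    (fun _ hq => h.fderiv_fderiv hq) (fun _ hq => h.fderiv_xi hq) hq u v w

end

/-- The equation of Gauss of an equiaffine hypersurface. -/
lemma curvature_eq (h : IsEquiaffineHypersurface f ξ cov S) (x : M) (u v w : TangentSpace I x) :
    curvature cov x u v w = (inner ℝ v w : ℝ) • S x u - (inner ℝ u w : ℝ) • S x v := by
  have hx := mem_extChartAt_source (I := I) x
  have hp := (extChartAt I x).map_source hx
  have key := (hypersurface_structure (isOpen_extChartAt_target x)
    (fun _ hq => (h.contDiffAt_comp_symm hq).contDiffWithinAt)
    (fun _ hq => (differentiableAt_metric hq).differentiableWithinAt)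
    (fun _ hq => (differentiableAt_christoffel h.smooth hq).differentiableWithinAt)
    (fun _ hq => ((StatGeom.contDiffAt_comp_symm hq
      h.smooth_xi.contMDiffAt).differentiableAt (by simp)).differentiableWithinAt)
    (fun _ hq => h.injective_fderiv hq) (fun _ hq => h.notMem_range_fderiv hq)
    (fun _ hq => h.fderiv_fderiv hq) (fun _ hq => h.fderiv_xi hq) hp
    (coord I x x u) (coord I x x v) (coord I x x w)).1
  rw [← coord_curvature h.smooth, metric_coord hx, metric_coord hx] at key
  -- The chart returns the base point only up to a propositional equality, on which the type of `S`
  -- depends; generalizing the point allows it to be replaced.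
  have hS : ∀ (y : M) (a : E), y = x →
      coord I x y (S y (frame x a y)) = coord I x x (S x (frame x a x)) := by
    rintro _ _ rfl
    rfl
  rw [hS _ _ ((extChartAt I x).left_inv hx), hS _ _ ((extChartAt I x).left_inv hx),
    frame_coord hx, frame_coord hx] at key
  rw [← frame_coord hx (curvature cov x u v w), key, ← frameL_apply hx, map_sub, map_smul, map_smul,
    frameL_apply hx, frameL_apply hx, frame_coord hx, frame_coord hx]

lemma scalarCurvature_sub {nablaHat : AffineConnection I M} (h : IsEquiaffineHypersurface f ξ cov S)
    (hHat : IsLeviCivita nablaHat) (x : M) :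
    scalarCurvature nablaHat x - scalarCurvature cov x =
      cubicNormSq (differenceTensor cov nablaHat) x
        - ‖traceField (differenceTensor cov nablaHat) x‖ ^ 2 ∧
    3 * ‖traceField (differenceTensor cov nablaHat) x‖ ^ 2 ≤
      (Module.finrank ℝ E + 2) * cubicNormSq (differenceTensor cov nablaHat) x :=
  scalarCurvature_sub_of_coord_symm hHat h.smooth x
    (fun _ hq => h.christoffel_symm hq) (fun _ hq => h.coordMetricDeriv_symm hq)

lemma curvature_eq_of_sphere (h : IsEquiaffineHypersurface f ξ cov S) {x : M} {κ : ℝ}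
    (hS : S x = κ • ContinuousLinearMap.id ℝ (TangentSpace I x)) (u v w : TangentSpace I x) :
    curvature cov x u v w = κ • R0 x u v w := by
  rw [h.curvature_eq, hS, R0, smul_sub, smul_smul, smul_smul]
  simp only [smul_apply, ContinuousLinearMap.id_apply, smul_smul, mul_comm]

end IsEquiaffineHypersurface

end Statistical

/-! ### Additivity and homogeneity of the coordinate curvature -/

section CoordCurvature

variable {E : Type*} [NormedAddCommGroup E] [NormedSpace ℝ E]

lemma coordCurvature_add_left (Γ : E → E →L[ℝ] E →L[ℝ] E) (p u u' v w : E) :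
    coordCurvature Γ p (u + u') v w = coordCurvature Γ p u v w + coordCurvature Γ p u' v w := by
  simp only [coordCurvature, map_add, add_apply]
  abel

lemma coordCurvature_smul (Γ : E → E →L[ℝ] E →L[ℝ] E) (p u v : E) (a : ℝ) :
    coordCurvature Γ p (a • u) (a • v) (a • v) = a ^ 3 • coordCurvature Γ p u v v := by
  simp only [coordCurvature, map_smul, smul_apply, ← smul_sub, ← smul_add, smul_smul]
  congr 1
  ring

end CoordCurvature

/-! ### Kähler manifolds and complex space forms -/

section Kahler

variable {E : Type*} [NormedAddCommGroup E] [NormedSpace ℝ E] [FiniteDimensional ℝ E]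
  {H : Type*} [TopologicalSpace H] {I : ModelWithCorners ℝ E H} [I.Boundaryless]
  {M : Type*} [TopologicalSpace M] [ChartedSpace H M] [IsManifold I ∞ M]

/-- The coordinate expression of a field of endomorphisms in the chart at `x₀`. -/
def coordEnd (J : ∀ x : M, TangentSpace I x →L[ℝ] TangentSpace I x) (x₀ : M) (q : E) : E →L[ℝ] E :=
  (coord I x₀ ((extChartAt I x₀).symm q)).comp
    ((J ((extChartAt I x₀).symm q)).comp (frameL I x₀ ((extChartAt I x₀).symm q)))

lemma coordEnd_apply (J : ∀ x : M, TangentSpace I x →L[ℝ] TangentSpace I x) {x₀ : M} {q : E}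
    (hq : q ∈ (extChartAt I x₀).target) (w : E) : coordEnd J x₀ q w =
      coord I x₀ _ (J ((extChartAt I x₀).symm q) (frame x₀ w _)) := by
  rw [← frameL_apply ((extChartAt I x₀).map_target hq)]
  rfl

lemma coordEnd_coord (J : ∀ x : M, TangentSpace I x →L[ℝ] TangentSpace I x) {x₀ y : M}
    (hy : y ∈ (extChartAt I x₀).source) (v : TangentSpace I y) :
    coordEnd J x₀ (extChartAt I x₀ y) (coord I x₀ y v) = coord I x₀ y (J y v) := by
  rw [coordEnd, (extChartAt I x₀).left_inv hy, ContinuousLinearMap.comp_apply,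
    ContinuousLinearMap.comp_apply, frameL_apply hy, frame_coord hy]

variable [RiemannianBundle (fun x : M => TangentSpace I x)]
  {cov : AffineConnection I M} {J : ∀ x : M, TangentSpace I x →L[ℝ] TangentSpace I x}

namespace IsKahler

lemma contMDiffAt_J_frame (h : IsKahler cov J) {x₀ y : M} (hy : y ∈ (extChartAt I x₀).source)
    (w : E) : ContMDiffAt I I.tangent ∞
      (fun y => (TotalSpace.mk' E y (J y (frame x₀ w y)) : TangentBundle I M)) y :=
  (h.smooth_J.contMDiffAt).clm_bundle_apply (contMDiffAt_frame hy w)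

lemma contDiffOn_coordEnd (h : IsKahler cov J) (x₀ : M) :
    ContDiffOn ℝ ∞ (coordEnd J x₀) (extChartAt I x₀).target := by
  rw [contDiffOn_clm_apply]
  intro w q hq
  have hy := (extChartAt I x₀).map_target hq
  have h1 := (contMDiffAt_section_iff_coord hy _).1 (h.contMDiffAt_J_frame hy w)
  refine ((contDiffAt_comp_symm hq h1).congr_of_eventuallyEq ?_).contDiffWithinAt
  filter_upwards [(isOpen_extChartAt_target (I := I) x₀).mem_nhds hq] with z hz
  exact coordEnd_apply J hz w

/-- Parallelism of $J$ tested on a coordinate field: $\partial_u(Jw)+\Gamma(Jw,u)=J\,\Gamma(w,u)$.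
-/
lemma fderiv_coordEnd (h : IsKahler cov J) {x₀ : M} {q : E}
    (hq : q ∈ (extChartAt I x₀).target) (u w : E) :
    fderiv ℝ (coordEnd J x₀) q u w = coordEnd J x₀ q (christoffel cov x₀ q w u)
      - christoffel cov x₀ q (coordEnd J x₀ q w) u := by
  have hy := (extChartAt I x₀).map_target hq
  have e := (extChartAt I x₀).right_inv hq
  have hd : DifferentiableAt ℝ (coordEnd J x₀) q :=
    ((h.contDiffOn_coordEnd x₀).contDiffAt
      ((isOpen_extChartAt_target x₀).mem_nhds hq)).differentiableAt (by simp)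
  have hs := (h.contMDiffAt_J_frame hy w).mdifferentiableAt (by simp)
  have key := congrArg (coord I x₀ _)
    (h.parallel _ (frame x₀ u _) (frame x₀ w) (mdifferentiableAt_frame hy w))
  have hE : (fun z => coord I x₀ z (J z (frame x₀ w z))) ∘ (extChartAt I x₀).symm =ᶠ[𝓝 q]
      fun q => coordEnd J x₀ q w := by
    filter_upwards [(isOpen_extChartAt_target (I := I) x₀).mem_nhds hq] with z hz
    exact (coordEnd_apply J hz w).symm
  rw [coord_cov cov hy hs, mvfderiv_frame hy (mdifferentiableAt_coord hy hs), cov_frame cov hy,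
    ← coordEnd_apply J hq, ← coordEnd_apply J hq, coord_frame hy] at key
  simp only [e] at key
  rw [hE.fderiv_eq, fderiv_apply_const hd] at key
  exact eq_sub_of_add_eq key

lemma inner_J_left (h : IsKahler cov J) (x : M) (u v : TangentSpace I x) :
    (inner ℝ (J x u) v : ℝ) = - inner ℝ u (J x v) := by
  rw [← h.hermitian, h.J_sq, inner_neg_left]

end IsKahler

variable [IsContMDiffRiemannianBundle I ∞ E (fun x : M => TangentSpace I x)] [T2Space M]

lemma inner_curvature (hcov : cov.ContMDiffCovariantDerivative ∞) (x : M)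
    (u v w t : TangentSpace I x) :
    (inner ℝ (curvature cov x u v w) t : ℝ) = metric I x (extChartAt I x x)
      (coordCurvature (christoffel cov x) (extChartAt I x x) (coord I x x u) (coord I x x v)
        (coord I x x w)) (coord I x x t) := by
  rw [← coord_curvature hcov, metric_coord (mem_extChartAt_source x)]

lemma coord_injective {x₀ y : M} (hy : y ∈ (extChartAt I x₀).source) :
    Function.Injective (coord I x₀ y) := fun u v h => by
  rw [← frame_coord hy u, h, frame_coord hy]

lemma curvature_J (h : IsKahler cov J) (x : M) (u v w : TangentSpace I x) :
    curvature cov x u v (J x w) = J x (curvature cov x u v w) := by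
  have hx := mem_extChartAt_source (I := I) x
  refine coord_injective hx ?_
  rw [coord_curvature h.leviCivita.smooth, ← coordEnd_coord J hx, ← coordEnd_coord J hx,
    (h.leviCivita.isCoordLeviCivita x).coordCurvature_parallel (mem_extChartAt_target x)
      (h.contDiffOn_coordEnd x) (fun _ hq => h.fderiv_coordEnd hq),
    coord_curvature h.leviCivita.smooth]

lemma inner_curvature_smul (hcov : cov.ContMDiffCovariantDerivative ∞) (x : M)
    (u v : TangentSpace I x) (a : ℝ) :
    (inner ℝ (curvature cov x (a • u) (a • v) (a • v)) (a • u) : ℝ) =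
      a ^ 4 * inner ℝ (curvature cov x u v v) u := by
  rw [inner_curvature hcov, inner_curvature hcov, map_smul (coord I x x) a u,
    map_smul (coord I x x) a v, coordCurvature_smul, map_smul, map_smul, smul_apply,
    smul_eq_mul, smul_eq_mul]
  ring

lemma curvature_add_left (hcov : cov.ContMDiffCovariantDerivative ∞) (x : M)
    (u u' v w : TangentSpace I x) :
    curvature cov x (u + u') v w = curvature cov x u v w + curvature cov x u' v w := by
  refine coord_injective (mem_extChartAt_source (I := I) x) ?_
  rw [map_add, coord_curvature hcov, coord_curvature hcov, coord_curvature hcov, map_add,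
    coordCurvature_add_left]

lemma curvature_swap (hcov : cov.ContMDiffCovariantDerivative ∞) (x : M)
    (u v w : TangentSpace I x) : curvature cov x v u w = - curvature cov x u v w := by
  refine coord_injective (mem_extChartAt_source (I := I) x) ?_
  rw [map_neg, coord_curvature hcov, coord_curvature hcov, coordCurvature_swap]

lemma IsLeviCivita.inner_curvature_swap (h : IsLeviCivita cov) (x : M)
    (u v w t : TangentSpace I x) :
    (inner ℝ (curvature cov x u v t) w : ℝ) = - inner ℝ (curvature cov x u v w) t := by
  have hc := h.isCoordLeviCivita x
  have := hc.metric_coordCurvature (mem_extChartAt_target (I := I) x) (coord I x x u)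
    (coord I x x v) (coord I x x w) (coord I x x t)
  rw [hc.metric_symm _ (coord I x x w)] at this
  rw [inner_curvature h.smooth, inner_curvature h.smooth]
  linarith

lemma IsLeviCivita.curvature_bianchi (h : IsLeviCivita cov) (x : M) (u v w : TangentSpace I x) :
    curvature cov x u v w + curvature cov x v w u + curvature cov x w u v = 0 := by
  refine coord_injective (mem_extChartAt_source (I := I) x) ?_
  rw [map_add, map_add, coord_curvature h.smooth, coord_curvature h.smooth,
    coord_curvature h.smooth, (h.isCoordLeviCivita x).bianchi (mem_extChartAt_target x), map_zero]

/-- $g(R(w,Jw)Jw,w)$ is homogeneous of degree 4 in $w$, so square norm 2 multiplies the value on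
unit vectors by $2^2$. This is the case of the sums and differences used in polarization. -/
lemma IsComplexSpaceForm.inner_curvature_of_norm_sq_eq_two {κ : ℝ}
    (h : IsComplexSpaceForm cov J κ) {x : M} {w : TangentSpace I x} (hw : ‖w‖ ^ 2 = 2) :
    (inner ℝ (curvature cov x w (J x w) (J x w)) w : ℝ) = 4 * κ := by
  have hw0 : ‖w‖ ≠ 0 := fun h0 => by norm_num [h0] at hw
  have h1 := h.holomorphic_curvature x (‖w‖⁻¹ • w) (by
    rw [norm_smul, norm_inv, norm_norm, inv_mul_cancel₀ hw0])
  have h4 : ‖w‖⁻¹ ^ 4 = 1 / 4 := by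
    rw [show ‖w‖⁻¹ ^ 4 = ((‖w‖ ^ 2)⁻¹) ^ 2 by ring, hw]
    norm_num
  rw [map_smul, inner_curvature_smul h.kahler.leviCivita.smooth, h4] at h1
  linarith

/-- Orthogonality of `u` to `v` and to $Jv$ is what makes $u\pm v$ and $u\pm Jv$ all of square norm
2, as polarization requires. -/
lemma IsComplexSpaceForm.four_mul_inner_curvature {κ : ℝ} (h : IsComplexSpaceForm cov J κ) {x : M}
    {u v : TangentSpace I x} (hu : ‖u‖ = 1) (hv : ‖v‖ = 1) (huv : (inner ℝ u v : ℝ) = 0)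
    (hJ : (inner ℝ u (J x v) : ℝ) = 0) :
    4 * (inner ℝ (curvature cov x u v v) u : ℝ) = κ := by
  have hL := h.kahler.leviCivita
  have hJv : ‖J x v‖ = 1 := by
    rw [← hv, ← sq_eq_sq₀ (norm_nonneg _) (norm_nonneg _), ← real_inner_self_eq_norm_sq,
      h.kahler.hermitian, real_inner_self_eq_norm_sq]
  have norm_add : ∀ a b : TangentSpace I x, ‖a‖ = 1 → ‖b‖ = 1 → (inner ℝ a b : ℝ) = 0 →
      ‖a + b‖ ^ 2 = 2 := by
    intro a b ha hb hab
    rw [norm_add_sq_real, ha, hb, hab]; norm_num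
  refine four_mul_sectional_eq (J := J x)
    (R := fun u v w t => (inner ℝ (curvature cov x u v w) t : ℝ)) ?_ ?_ ?_ ?_ ?_
    (map_add _) (h.kahler.J_sq x) (h.holomorphic_curvature x u hu) (h.holomorphic_curvature x v hv)
    (h.inner_curvature_of_norm_sq_eq_two (norm_add _ _ hu hv huv))
    (h.inner_curvature_of_norm_sq_eq_two (norm_add _ _ hu (by rwa [norm_neg])
      (by rw [inner_neg_right, huv, neg_zero])))
    (h.inner_curvature_of_norm_sq_eq_two (norm_add _ _ hu hJv hJ))
    (h.inner_curvature_of_norm_sq_eq_two (norm_add _ _ hu (by rwa [norm_neg])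
      (by rw [inner_neg_right, hJ, neg_zero])))
  · intro x y v w t
    rw [curvature_add_left hL.smooth, inner_add_left]
  · intro u v w t
    rw [curvature_swap hL.smooth, inner_neg_left]
  · exact hL.inner_curvature_swap x
  · intro u v w t
    rw [← inner_add_left, ← inner_add_left, hL.curvature_bianchi, inner_zero_left]
  · intro u v w t
    rw [curvature_J h.kahler, h.kahler.hermitian]

end Kahler

lemma IsCoordLeviCivita.mono {E : Type*} [NormedAddCommGroup E] [NormedSpace ℝ E]
    {G : E → E →L[ℝ] E →L[ℝ] ℝ} {Γ : E → E →L[ℝ] E →L[ℝ] E} {O U : Set E}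
    (h : IsCoordLeviCivita G Γ O) (hU : IsOpen U) (hUO : U ⊆ O) : IsCoordLeviCivita G Γ U where
  isOpen := hU
  contDiffOn_metric := h.contDiffOn_metric.mono hUO
  contDiffOn_christoffel := h.contDiffOn_christoffel.mono hUO
  metric_symm := h.metric_symm
  christoffel_symm q hq := h.christoffel_symm q (hUO hq)
  fderiv_metric q hq := h.fderiv_metric q (hUO hq)

/-! ### Maps between manifolds in charts -/

section LocalRepresentative

variable {E : Type*} [NormedAddCommGroup E] [NormedSpace ℝ E] [FiniteDimensional ℝ E]
  {H : Type*} [TopologicalSpace H] {I : ModelWithCorners ℝ E H} [I.Boundaryless]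
  {M : Type*} [TopologicalSpace M] [ChartedSpace H M] [IsManifold I ∞ M]
  {E' : Type*} [NormedAddCommGroup E'] [NormedSpace ℝ E'] [FiniteDimensional ℝ E']
  {H' : Type*} [TopologicalSpace H'] {I' : ModelWithCorners ℝ E' H'} [I'.Boundaryless]
  {N : Type*} [TopologicalSpace N] [ChartedSpace H' N] [IsManifold I' ∞ N]

lemma mvfderiv_extChartAt {x₀ y : M} (hy : y ∈ (extChartAt I x₀).source) (v : TangentSpace I y) :
    mvfderiv I (extChartAt I x₀) y v = coord I x₀ y v := by
  have hd : MDifferentiableAt I 𝓘(ℝ, E) (extChartAt I x₀) y :=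
    mdifferentiableAt_extChartAt (by rwa [extChartAt_source] at hy)
  have hE : (extChartAt I x₀) ∘ (extChartAt I x₀).symm =ᶠ[𝓝 (extChartAt I x₀ y)] id := by
    filter_upwards [(isOpen_extChartAt_target (I := I) x₀).mem_nhds
      ((extChartAt I x₀).map_source hy)] with z hz
    exact (extChartAt I x₀).right_inv hz
  rw [mvfderiv_eq_fderiv_coord hy hd, hE.fderiv_eq, fderiv_id]
  rfl

variable (I I') in
/-- The expression of `f` in the charts at `x₀` and `f x₀`. -/
def localRep (f : M → N) (x₀ : M) : E → E' :=
  ((extChartAt I' (f x₀)) ∘ f) ∘ (extChartAt I x₀).symm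

variable (I I') in
/-- The coordinate domain of `localRep`. -/
def localDomain (f : M → N) (x₀ : M) : Set E :=
  (extChartAt I x₀).target ∩ (f ∘ (extChartAt I x₀).symm) ⁻¹' (extChartAt I' (f x₀)).source

lemma isOpen_localDomain {f : M → N} (hf : ContMDiff I I' ∞ f) (x₀ : M) :
    IsOpen (localDomain I I' f x₀) :=
  (hf.continuous.comp_continuousOn (continuousOn_extChartAt_symm x₀)).isOpen_inter_preimage
    (isOpen_extChartAt_target x₀) (isOpen_extChartAt_source _)

lemma mapsTo_localRep (f : M → N) (x₀ : M) :
    MapsTo (localRep I I' f x₀) (localDomain I I' f x₀) (extChartAt I' (f x₀)).target :=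
  fun _ hq => (extChartAt I' (f x₀)).map_source hq.2

lemma mem_localDomain (f : M → N) (x₀ : M) : extChartAt I x₀ x₀ ∈ localDomain I I' f x₀ := by
  refine ⟨mem_extChartAt_target x₀, ?_⟩
  rw [mem_preimage, Function.comp_apply, extChartAt_to_inv]
  exact mem_extChartAt_source _

lemma localRep_self (f : M → N) (x₀ : M) :
    localRep I I' f x₀ (extChartAt I x₀ x₀) = extChartAt I' (f x₀) (f x₀) := by
  rw [localRep, Function.comp_apply, extChartAt_to_inv, Function.comp_apply]

section

variable {f : M → N} (hf : ContMDiff I I' ∞ f) {x₀ : M}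

include hf

lemma contMDiffAt_extChartAt_comp {y : M} (hy : f y ∈ (extChartAt I' (f x₀)).source) :
    ContMDiffAt I 𝓘(ℝ, E') ∞ ((extChartAt I' (f x₀)) ∘ f) y :=
  (contMDiffAt_extChartAt' (by rwa [extChartAt_source] at hy)).comp y hf.contMDiffAt

lemma contDiffOn_localRep : ContDiffOn ℝ ∞ (localRep I I' f x₀) (localDomain I I' f x₀) :=
  fun _ hq => (contDiffAt_comp_symm hq.1 (contMDiffAt_extChartAt_comp hf hq.2)).contDiffWithinAt

lemma fderiv_localRep_extChartAt {y : M} (hy : y ∈ (extChartAt I x₀).source)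
    (hfy : f y ∈ (extChartAt I' (f x₀)).source) (v : E) :
    fderiv ℝ (localRep I I' f x₀) (extChartAt I x₀ y) v =
      coord I' (f x₀) (f y) (mfderiv I I' f y (frame x₀ v y)) := by
  have hd := (contMDiffAt_extChartAt_comp hf hfy).mdifferentiableAt (by simp)
  rw [localRep, ← mvfderiv_frame hy hd, ← mvfderiv_extChartAt hfy]
  simp only [mvfderiv]
  rw [mfderiv_comp y (mdifferentiableAt_extChartAt (by rwa [extChartAt_source] at hfy))
    (hf.mdifferentiableAt (by simp))]
  rfl

lemma fderiv_localRep {q : E} (hq : q ∈ localDomain I I' f x₀) (v : E) :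
    fderiv ℝ (localRep I I' f x₀) q v = coord I' (f x₀) (f ((extChartAt I x₀).symm q))
      (mfderiv I I' f ((extChartAt I x₀).symm q) (frame x₀ v _)) := by
  rw [← fderiv_localRep_extChartAt hf ((extChartAt I x₀).map_target hq.1) hq.2,
    (extChartAt I x₀).right_inv hq.1]

lemma fderiv_localRep_coord (u : TangentSpace I x₀) :
    fderiv ℝ (localRep I I' f x₀) (extChartAt I x₀ x₀) (coord I x₀ x₀ u) =
      coord I' (f x₀) (f x₀) (mfderiv I I' f x₀ u) := by
  rw [fderiv_localRep_extChartAt hf (mem_extChartAt_source x₀) (mem_extChartAt_source _),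
    frame_coord (mem_extChartAt_source x₀)]

/-- The derivative along `f` of `f_* v` in coordinates. -/
lemma coord_covAlong (cov : AffineConnection I' N) (u v : TangentSpace I x₀) :
    coord I' (f x₀) (f x₀) (covAlong I cov f (fun y => mfderiv I I' f y (extend E v y)) x₀ u) =
      coordSecondDeriv (christoffel cov (f x₀)) (localRep I I' f x₀) (extChartAt I x₀ x₀)
        (coord I x₀ x₀ u) (coord I x₀ x₀ v) := by
  have hx := mem_extChartAt_source (I := I) x₀
  have hfx := mem_extChartAt_source (I := I') (f x₀)
  set g : M → E' := fun y => (trivializationAt E' (TangentSpace I' : N → Type _) (f x₀)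
    ⟨f y, mfderiv I I' f y (extend E v y)⟩).2 with hg
  set D : E → E' := fun q => fderiv ℝ (localRep I I' f x₀) q (coord I x₀ x₀ v) with hD
  have hdD : DifferentiableAt ℝ D (extChartAt I x₀ x₀) :=
    (contDiffAt_fderiv_apply ((contDiffOn_localRep hf).contDiffAt
      ((isOpen_localDomain hf x₀).mem_nhds (mem_localDomain f x₀))) _).differentiableAt (by simp)
  -- Since `v` is extended with constant coefficients, the coefficients of $f_*V$ in the target
  -- chart are a directional derivative of the local representative in a fixed direction.
  have hE : g =ᶠ[𝓝 x₀] D ∘ extChartAt I x₀ := by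
    filter_upwards [extChartAt_source_mem_nhds (I := I) x₀, hf.continuous.continuousAt.preimage_mem_nhds
      (extChartAt_source_mem_nhds (I := I') (f x₀))] with y hy hfy
    rw [Function.comp_apply, hD, hg]
    simp only
    rw [fderiv_localRep_extChartAt hf hy hfy, extend_eq_frame, coord_apply hfy]
  have hm : MDifferentiableAt I 𝓘(ℝ, E') g x₀ :=
    (hdD.mdifferentiableAt.comp _ (mdifferentiableAt_extChartAt
      (mem_chart_source H x₀))).congr_of_eventuallyEq hE
  have hE' : g ∘ (extChartAt I x₀).symm =ᶠ[𝓝 (extChartAt I x₀ x₀)] D := by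
    filter_upwards [(isOpen_localDomain hf x₀).mem_nhds (mem_localDomain (I' := I') f x₀)] with q hq
    rw [Function.comp_apply, hD, hg]
    simp only
    rw [fderiv_localRep hf hq, extend_eq_frame]
    exact (coord_apply hq.2 _).symm
  rw [covAlong, map_add]
  congr 1
  · rw [← hE'.fderiv_eq, ← mvfderiv_eq_fderiv_coord hx hm]
    exact coord_frame hfx _
  · rw [extend_eq_frame, coord_cov_frame cov hfx, localRep_self, fderiv_localRep_coord hf,
      fderiv_localRep_coord hf, extend_eq_frame, frame_coord hx]

end

end LocalRepresentative

/-! ### Lagrangian immersions: second fundamental form, Gauss equation, scalar curvature -/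

section Lagrangian

variable {E : Type*} [NormedAddCommGroup E] [NormedSpace ℝ E] [FiniteDimensional ℝ E]
  {H : Type*} [TopologicalSpace H] {I : ModelWithCorners ℝ E H} [I.Boundaryless]
  {M : Type*} [TopologicalSpace M] [ChartedSpace H M] [IsManifold I ∞ M]
  [RiemannianBundle (fun x : M => TangentSpace I x)]
  [IsContMDiffRiemannianBundle I ∞ E (fun x : M => TangentSpace I x)] [T2Space M]
  {E' : Type*} [NormedAddCommGroup E'] [NormedSpace ℝ E'] [FiniteDimensional ℝ E']
  {H' : Type*} [TopologicalSpace H'] {I' : ModelWithCorners ℝ E' H'} [I'.Boundaryless]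
  {N : Type*} [TopologicalSpace N] [ChartedSpace H' N] [IsManifold I' ∞ N]
  [RiemannianBundle (fun y : N => TangentSpace I' y)]
  [IsContMDiffRiemannianBundle I' ∞ E' (fun y : N => TangentSpace I' y)] [T2Space N]

/-- The tangent vector with coordinates `Γ(v, u)`. -/
def christoffelVector (cov : AffineConnection I M) (x : M) (u v : TangentSpace I x) :
    TangentSpace I x :=
  frame x (christoffel cov x (extChartAt I x x) (coord I x x v) (coord I x x u)) x

lemma coord_christoffelVector (cov : AffineConnection I M) (x : M) (u v : TangentSpace I x) :
    coord I x x (christoffelVector cov x u v) =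
      christoffel cov x (extChartAt I x x) (coord I x x v) (coord I x x u) :=
  coord_frame (mem_extChartAt_source x) _

/-- The covariant derivative along `f` of `f_* V`, where `V` extends `v` with constant
coefficients. -/
abbrev covMap (cov : AffineConnection I' N) (f : M → N) (x : M) (u v : TangentSpace I x) :
    TangentSpace I' (f x) :=
  covAlong I cov f (fun y => mfderiv I I' f y (extend E v y)) x u

variable {nablaHat : AffineConnection I M} {nablaN : AffineConnection I' N}
  {J : ∀ y : N, TangentSpace I' y →L[ℝ] TangentSpace I' y} {f : M → N}

section

variable (hf : IsLagrangianImmersion (I := I) f J)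

include hf

lemma metric_fderiv_localRep {x₀ : M} {q : E} (hq : q ∈ localDomain I I' f x₀) (v w : E) :
    metric I' (f x₀) (localRep I I' f x₀ q) (fderiv ℝ (localRep I I' f x₀) q v)
      (fderiv ℝ (localRep I I' f x₀) q w) = metric I x₀ q v w := by
  rw [fderiv_localRep hf.smooth hq, fderiv_localRep hf.smooth hq]
  refine (metric_coord hq.2 _ _).trans ?_
  refine (hf.isometric _ _ _).trans ?_
  rw [← metric_extChartAt ((extChartAt I x₀).map_target hq.1), (extChartAt I x₀).right_inv hq.1]

lemma metric_coordEnd_fderiv_localRep {x₀ : M} {q : E} (hq : q ∈ localDomain I I' f x₀) (v w : E) :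
    metric I' (f x₀) (localRep I I' f x₀ q)
      (coordEnd J (f x₀) (localRep I I' f x₀ q) (fderiv ℝ (localRep I I' f x₀) q v))
      (fderiv ℝ (localRep I I' f x₀) q w) = 0 := by
  rw [fderiv_localRep hf.smooth hq, fderiv_localRep hf.smooth hq]
  have h1 := coordEnd_coord J hq.2
    (mfderiv I I' f ((extChartAt I x₀).symm q) (frame x₀ v ((extChartAt I x₀).symm q)))
  refine (congrArg (fun z => metric I' (f x₀) (localRep I I' f x₀ q) z
    (coord I' (f x₀) _ (mfderiv I I' f ((extChartAt I x₀).symm q) (frame x₀ w _)))) h1).trans ?_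
  exact (metric_coord hq.2 _ _).trans (hf.lagrangian _ _ _)

section

variable (hHat : IsLeviCivita nablaHat) (hN : IsLeviCivita nablaN)

include hHat hN

lemma inner_covMap (x : M) (u v w : TangentSpace I x) :
    (inner ℝ (covMap nablaN f x u v) (mfderiv I I' f x w) : ℝ) =
      inner ℝ (christoffelVector nablaHat x u v) w := by
  have key := metric_coordSecondDeriv ((hHat.isCoordLeviCivita x).mono
    (isOpen_localDomain hf.smooth x) inter_subset_left) (hN.isCoordLeviCivita (f x))
    (contDiffOn_localRep hf.smooth) (mapsTo_localRep f x)
    (fun _ hq => metric_fderiv_localRep hf hq) (mem_localDomain f x)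
    (coord I x x u) (coord I x x v) (coord I x x w)
  rwa [fderiv_localRep_coord hf.smooth, localRep_self, ← coord_covAlong hf.smooth,
    ← coord_christoffelVector, metric_coord (mem_extChartAt_source (f x)),
    metric_coord (mem_extChartAt_source x)] at key

/-- The orthogonal projection is characterized by the residue: subtracting $f_*$ of the Christoffel
vector leaves something normal to $f$ by `inner_covMap`, and what was subtracted is tangent. -/
lemma secondFundamentalForm_eq (x : M) (u v : TangentSpace I x) :
    secondFundamentalForm I nablaN f x u v =
      covMap nablaN f x u v - mfderiv I I' f x (christoffelVector nablaHat x u v) := by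
  refine Submodule.eq_starProjection_of_mem_orthogonal ?_ ?_
  · rw [Submodule.mem_orthogonal']
    rintro _ ⟨w, rfl⟩
    rw [inner_sub_left]
    exact sub_eq_zero.2 ((inner_covMap hf hHat hN x u v w).trans (hf.isometric x _ w).symm)
  · refine Submodule.le_orthogonal_orthogonal _ ⟨christoffelVector nablaHat x u v, ?_⟩
    rw [sub_sub_cancel]
    rfl

lemma covMap_eq (x : M) (u v : TangentSpace I x) :
    covMap nablaN f x u v = secondFundamentalForm I nablaN f x u v
      + mfderiv I I' f x (christoffelVector nablaHat x u v) := by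
  rw [secondFundamentalForm_eq hf hHat hN, sub_add_cancel]

lemma inner_secondFundamentalForm (x : M) (u v w : TangentSpace I x) :
    (inner ℝ (secondFundamentalForm I nablaN f x u v) (mfderiv I I' f x w) : ℝ) = 0 := by
  rw [secondFundamentalForm_eq hf hHat hN, inner_sub_left, inner_covMap hf hHat hN, hf.isometric,
    sub_self]

lemma secondFundamentalForm_symm (x : M) (u v : TangentSpace I x) :
    secondFundamentalForm I nablaN f x u v = secondFundamentalForm I nablaN f x v u := by
  have h1 : covMap nablaN f x u v = covMap nablaN f x v u := by
    refine coord_injective (mem_extChartAt_source (I := I') (f x)) ?_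
    rw [coord_covAlong hf.smooth, coord_covAlong hf.smooth,
      coordSecondDeriv_symm (hN.isCoordLeviCivita (f x))
        ((contDiffOn_localRep hf.smooth).contDiffAt
          ((isOpen_localDomain hf.smooth x).mem_nhds (mem_localDomain f x)))
        (mapsTo_localRep f x (mem_localDomain f x))]
  rw [secondFundamentalForm_eq hf hHat hN, secondFundamentalForm_eq hf hHat hN, h1,
    christoffelVector, (hHat.isCoordLeviCivita x).christoffel_symm _ (mem_extChartAt_target x)]
  rfl

/-- Normal and tangential parts are orthogonal. The Christoffel products appearing here are those on
the right side of `gauss_equation`, which they cancel. -/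
lemma inner_covMap_covMap (x : M) (u v w t : TangentSpace I x) :
    (inner ℝ (covMap nablaN f x u v) (covMap nablaN f x w t) : ℝ) =
      inner ℝ (secondFundamentalForm I nablaN f x u v) (secondFundamentalForm I nablaN f x w t)
      + inner ℝ (christoffelVector nablaHat x u v) (christoffelVector nablaHat x w t) := by
  rw [covMap_eq hf hHat hN, covMap_eq hf hHat hN, inner_add_left, inner_add_right, inner_add_right,
    inner_secondFundamentalForm hf hHat hN, hf.isometric, real_inner_comm _ (mfderiv I I' f x _),
    inner_secondFundamentalForm hf hHat hN]
  ring

/-- The equation of Gauss. -/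
lemma inner_curvature_eq (x : M) (u v w t : TangentSpace I x) :
    (inner ℝ (curvature nablaHat x u v w) t : ℝ) =
      inner ℝ (curvature nablaN (f x) (mfderiv I I' f x u) (mfderiv I I' f x v)
        (mfderiv I I' f x w)) (mfderiv I I' f x t)
      + inner ℝ (secondFundamentalForm I nablaN f x v w) (secondFundamentalForm I nablaN f x u t)
      - inner ℝ (secondFundamentalForm I nablaN f x u w)
        (secondFundamentalForm I nablaN f x v t) := by
  have key := gauss_equation ((hHat.isCoordLeviCivita x).mono (isOpen_localDomain hf.smooth x)
      inter_subset_left) (hN.isCoordLeviCivita (f x)) (contDiffOn_localRep hf.smooth)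
      (mapsTo_localRep f x) (fun _ hq => metric_fderiv_localRep hf hq) (mem_localDomain f x)
      (coord I x x u) (coord I x x v) (coord I x x w) (coord I x x t)
  simp only [fderiv_localRep_coord hf.smooth, localRep_self, ← coord_covAlong hf.smooth,
    ← coord_christoffelVector] at key
  have h1 := inner_covMap_covMap hf hHat hN x v w u t
  have h2 := inner_covMap_covMap hf hHat hN x u w v t
  rw [← inner_curvature hN.smooth, ← inner_curvature hHat.smooth,
    metric_coord (mem_extChartAt_source (f x)), metric_coord (mem_extChartAt_source (f x)),
    metric_coord (mem_extChartAt_source x), metric_coord (mem_extChartAt_source x)] at key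
  linarith

end

variable (hHat : IsLeviCivita nablaHat) (hN : IsKahler nablaN J)

include hHat hN

/-- The derivative of the Lagrangian condition gives this for the full covariant derivatives. Their
tangential parts drop out because $J$ maps tangent vectors to normal ones, and skewness of $J$ moves
it to the other factor. With the symmetry of $\sigma$, the cubic form of $J\sigma$ is totally
symmetric. -/
lemma inner_J_secondFundamentalForm (x : M) (u v w : TangentSpace I x) :
    (inner ℝ (J (f x) (secondFundamentalForm I nablaN f x u v)) (mfderiv I I' f x w) : ℝ) =
      inner ℝ (J (f x) (secondFundamentalForm I nablaN f x u w)) (mfderiv I I' f x v) := by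
  have key := metric_coordSecondDeriv_lagrangian ((hHat.isCoordLeviCivita x).mono
      (isOpen_localDomain hf.smooth x) inter_subset_left) (hN.leviCivita.isCoordLeviCivita (f x))
      (contDiffOn_localRep hf.smooth) (mapsTo_localRep f x) (hN.contDiffOn_coordEnd (f x))
      (fun _ hq => hN.fderiv_coordEnd hq) (fun _ hq => metric_coordEnd_fderiv_localRep hf hq)
      (mem_localDomain f x) (coord I x x u) (coord I x x v) (coord I x x w)
  have hfx := mem_extChartAt_source (I := I') (f x)
  rw [fderiv_localRep_coord hf.smooth, fderiv_localRep_coord hf.smooth, localRep_self,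
    ← coord_covAlong hf.smooth, ← coord_covAlong hf.smooth, coordEnd_coord J hfx,
    coordEnd_coord J hfx, metric_coord hfx, metric_coord hfx] at key
  have h1 := covMap_eq hf hHat hN.leviCivita x u v
  have h2 := covMap_eq hf hHat hN.leviCivita x u w
  rw [covMap] at h1 h2
  rw [h1, h2, map_add, inner_add_left, inner_add_right, hf.lagrangian, hf.lagrangian,
    hN.inner_J_left _ (mfderiv I I' f x v),
    real_inner_comm _ (mfderiv I I' f x v)] at key
  linarith

end

section

variable {K : ∀ x : M, TangentSpace I x → TangentSpace I x → TangentSpace I x}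
  (hf : IsLagrangianImmersion (I := I) f J) (hHat : IsLeviCivita nablaHat)
  (hN : IsKahler nablaN J) (hK : IsInducedTensor nablaN J f K)

include hf hN hK in
-- Both $f_*$ and $J$ preserve inner products, so $K$ and $\sigma$ have the same norms and traces of
-- equal length.
lemma inner_inducedTensor (x : M) (u v w t : TangentSpace I x) :
    (inner ℝ (K x u v) (K x w t) : ℝ) = inner ℝ (secondFundamentalForm I nablaN f x u v)
      (secondFundamentalForm I nablaN f x w t) := by
  rw [← hf.isometric, hK, hK, hN.hermitian]

include hf hHat hN hK

lemma three_mul_norm_traceField_inducedTensor_le (x : M) :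
    3 * ‖traceField K x‖ ^ 2 ≤ (Module.finrank ℝ E + 2) * cubicNormSq K x := by
  have hc : ∀ u v w, cubicForm K x u v w =
      inner ℝ (J (f x) (secondFundamentalForm I nablaN f x u v)) (mfderiv I I' f x w) := by
    intro u v w
    rw [cubicForm, ← hf.isometric, hK]
  have h12 : ∀ u v, K x u v = K x v u := by
    intro u v
    refine hf.immersion x ?_
    rw [hK, hK, secondFundamentalForm_symm hf hHat hN.leviCivita]
  have h23 : ∀ u v w, cubicForm K x u v w = cubicForm K x u w v := by
    intro u v w
    rw [hc, hc, inner_J_secondFundamentalForm hf hHat hN]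
  refine three_mul_norm_traceField_sq_le K x h12 fun u v w => ?_
  rw [h23, cubicForm, h12, ← cubicForm, h23]

omit hHat in
lemma norm_traceField_sq_inducedTensor (x : M) :
    ‖traceField K x‖ ^ 2 =
      (Module.finrank ℝ E : ℝ) ^ 2 * ‖meanCurvature I nablaN f x‖ ^ 2 := by
  have h0 : ‖traceField K x‖ ^ 2 = ‖∑ i, secondFundamentalForm I nablaN f x
      (stdOrthonormalBasis ℝ (TangentSpace I x) i)
      (stdOrthonormalBasis ℝ (TangentSpace I x) i)‖ ^ 2 := by
    rw [norm_traceField_sq, ← real_inner_self_eq_norm_sq, inner_sum]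
    simp only [sum_inner, inner_inducedTensor hf hN hK]
  rw [h0, meanCurvature, norm_smul, mul_pow, Real.norm_eq_abs, sq_abs]
  -- In dimension 0 the factor $1/n$ is the default value 0 and cannot be cancelled, but the trace
  -- is then an empty sum.
  by_cases hn : (Module.finrank ℝ E : ℝ) = 0
  · have : IsEmpty (Fin (Module.finrank ℝ (TangentSpace I x))) := by
      have h1 : Module.finrank ℝ (TangentSpace I x) = 0 := by exact_mod_cast hn
      rw [h1]
      infer_instance
    simp [hn]
  · field_simp

/-- The trace of the Gauss equation. Tangent planes of $f$ are totally real, hence have ambient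
sectional curvature $4c/4=c$; the terms in $\sigma$ become those in $K$. -/
lemma scalarCurvature_eq_of_lagrangian {c : ℝ} (hM : IsComplexSpaceForm nablaN J (4 * c)) (x : M) :
    scalarCurvature nablaHat x = c * (Module.finrank ℝ E * (Module.finrank ℝ E - 1))
      + ‖traceField K x‖ ^ 2 - cubicNormSq K x := by
  set b := stdOrthonormalBasis ℝ (TangentSpace I x) with hb
  have hR : ∀ i j, (inner ℝ (curvature nablaN (f x) (mfderiv I I' f x (b i))
      (mfderiv I I' f x (b j)) (mfderiv I I' f x (b j))) (mfderiv I I' f x (b i)) : ℝ) =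
      c * inner ℝ (R0 x (b i) (b j) (b j)) (b i) := by
    have hnorm : ∀ i, ‖mfderiv I I' f x (b i)‖ = 1 := by
      intro i
      rw [← sq_eq_sq₀ (norm_nonneg _) zero_le_one, ← real_inner_self_eq_norm_sq, hf.isometric,
        real_inner_self_eq_norm_sq, b.norm_eq_one]
    intro i j
    rw [R0, inner_sub_left, real_inner_smul_left, real_inner_smul_left,
      real_inner_self_eq_norm_sq, real_inner_self_eq_norm_sq, b.norm_eq_one, b.norm_eq_one]
    -- Polarization applies to orthonormal pairs only; on the diagonal both sides vanish, the left
    -- one by skewness of the curvature.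
    rcases eq_or_ne i j with rfl | hij
    · have := congrArg (fun z => (inner ℝ z (mfderiv I I' f x (b i)) : ℝ))
        (curvature_swap hN.leviCivita.smooth (f x) (mfderiv I I' f x (b i))
          (mfderiv I I' f x (b i)) (mfderiv I I' f x (b i)))
      simp only [inner_neg_left] at this
      rw [real_inner_self_eq_norm_sq, b.norm_eq_one]
      linarith
    · have h0 : (inner ℝ (b i) (b j) : ℝ) = 0 := b.orthonormal.2 hij
      have := hM.four_mul_inner_curvature (hnorm i) (hnorm j) ((hf.isometric x _ _).trans h0)
        (by rw [real_inner_comm, hf.lagrangian])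
      rw [h0]
      linarith
  simp only [scalarCurvature, ricci, ← hb, inner_curvature_eq hf hHat hN.leviCivita, hR,
    Finset.sum_sub_distrib, Finset.sum_add_distrib, ← Finset.mul_sum]
  rw [sum_inner_R0, cubicNormSq_eq, norm_traceField_sq, Finset.sum_comm (f := fun i j =>
    (inner ℝ (K x _ _) (K x _ _) : ℝ))]
  simp only [inner_inducedTensor hf hN hK, ← hb,
    fun i j => secondFundamentalForm_symm hf hHat hN.leviCivita x (b j) (b i)]

end

end Lagrangian

end StatGeom

end

/-! ### Assembly of the three statements -/

theorem theorem3p5 (n : ℕ)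
    {M : Type*} [TopologicalSpace M] [T2Space M] [ChartedSpace (EuclideanSpace ℝ (Fin n)) M]
    [IsManifold (𝓡 n) ∞ M]
    [RiemannianBundle (fun x : M => TangentSpace (𝓡 n) x)]
    [IsContMDiffRiemannianBundle (𝓡 n) ∞ (EuclideanSpace ℝ (Fin n))
      (fun x : M => TangentSpace (𝓡 n) x)]
    (nablaHat : StatGeom.AffineConnection (𝓡 n) M) (hHat : StatGeom.IsLeviCivita nablaHat) :
    -- arbitrary statistical structures
    (∀ nabla : StatGeom.AffineConnection (𝓡 n) M, StatGeom.IsStatistical nabla → ∀ x : M,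
      StatGeom.scalarCurvature nablaHat x - StatGeom.scalarCurvature nabla x
          = StatGeom.cubicNormSq (StatGeom.differenceTensor nabla nablaHat) x
            - ‖StatGeom.traceField (StatGeom.differenceTensor nabla nablaHat) x‖ ^ 2 ∧
      StatGeom.cubicNormSq (StatGeom.differenceTensor nabla nablaHat) x
            - ‖StatGeom.traceField (StatGeom.differenceTensor nabla nablaHat) x‖ ^ 2
          ≥ -(((n : ℝ) - 1) / 3)
              * StatGeom.cubicNormSq (StatGeom.differenceTensor nabla nablaHat) x ∧
      StatGeom.cubicNormSq (StatGeom.differenceTensor nabla nablaHat) x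
            - ‖StatGeom.traceField (StatGeom.differenceTensor nabla nablaHat) x‖ ^ 2
          ≥ -(((n : ℝ) - 1) / ((n : ℝ) + 2))
              * ‖StatGeom.traceField (StatGeom.differenceTensor nabla nablaHat) x‖ ^ 2) ∧
    -- Lagrangian submanifolds of a complex space form of holomorphic sectional curvature `4 c`
    (∀ (N : Type*) [TopologicalSpace N] [T2Space N]
      [ChartedSpace (EuclideanSpace ℝ (Fin (2 * n))) N] [IsManifold (𝓡 (2 * n)) ∞ N]
      [RiemannianBundle (fun y : N => TangentSpace (𝓡 (2 * n)) y)]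
      [IsContMDiffRiemannianBundle (𝓡 (2 * n)) ∞ (EuclideanSpace ℝ (Fin (2 * n)))
        (fun y : N => TangentSpace (𝓡 (2 * n)) y)]
      (nablaN : StatGeom.AffineConnection (𝓡 (2 * n)) N)
      (J : ∀ y : N, TangentSpace (𝓡 (2 * n)) y →L[ℝ] TangentSpace (𝓡 (2 * n)) y) (c : ℝ)
      (f : M → N)
      (K : ∀ x : M, TangentSpace (𝓡 n) x → TangentSpace (𝓡 n) x → TangentSpace (𝓡 n) x),
      StatGeom.IsComplexSpaceForm nablaN J (4 * c) →
      StatGeom.IsLagrangianImmersion (I := 𝓡 n) f J →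
      StatGeom.IsInducedTensor nablaN J f K →
      ∀ x : M,
        StatGeom.scalarCurvature nablaHat x
            ≤ (n : ℝ) * ((n : ℝ) - 1) / ((n : ℝ) + 2)
              * (c * ((n : ℝ) + 2) + (n : ℝ) * ‖StatGeom.meanCurvature (𝓡 n) nablaN f x‖ ^ 2) ∧
        StatGeom.scalarCurvature nablaHat x
            ≤ ((n : ℝ) - 1) / 3 * (3 * c * (n : ℝ) + StatGeom.cubicNormSq K x)) ∧
    -- equiaffine spheres
    (∀ (f ξ : M → EuclideanSpace ℝ (Fin (n + 1))) (nabla : StatGeom.AffineConnection (𝓡 n) M)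
      (S : ∀ x : M, TangentSpace (𝓡 n) x →L[ℝ] TangentSpace (𝓡 n) x) (H : M → ℝ),
      StatGeom.IsEquiaffineHypersurface f ξ nabla S →
      (∀ x : M, S x = H x • ContinuousLinearMap.id ℝ (TangentSpace (𝓡 n) x)) →
      ∀ x : M,
        (∀ u v w : TangentSpace (𝓡 n) x,
          StatGeom.curvature nabla x u v w = H x • StatGeom.R0 x u v w) ∧
        StatGeom.scalarCurvature nablaHat x
            ≥ ((n : ℝ) - 1) / ((n : ℝ) + 2)
              * (H x * (n : ℝ) * ((n : ℝ) + 2)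
                - ‖StatGeom.traceField (StatGeom.differenceTensor nabla nablaHat) x‖ ^ 2) ∧
        StatGeom.scalarCurvature nablaHat x
            ≥ ((n : ℝ) - 1) / 3
              * (3 * H x * (n : ℝ)
                - StatGeom.cubicNormSq (StatGeom.differenceTensor nabla nablaHat) x)) := by
  have hfin : (Module.finrank ℝ (EuclideanSpace ℝ (Fin n)) : ℝ) = n := by
    rw [finrank_euclideanSpace_fin]
  have hn : (0 : ℝ) ≤ n := n.cast_nonneg
  have hn2 : (n : ℝ) + 2 ≠ 0 := by positivity
  refine ⟨fun nabla h x => ?_, fun N _ _ _ _ _ _ nablaN J c f K hN hf hK x => ?_,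
    fun f ξ nabla S H h hS x => ?_⟩
  · obtain ⟨h1, h2⟩ := h.scalarCurvature_sub hHat x
    rw [hfin] at h2
    exact ⟨h1, StatGeom.neg_mul_le_sub_of_three_mul_le h2,
      StatGeom.neg_div_mul_le_sub_of_three_mul_le hn h2⟩
  · have h1 := StatGeom.scalarCurvature_eq_of_lagrangian hf hHat hN.kahler hK hN x
    have h2 := StatGeom.three_mul_norm_traceField_inducedTensor_le hf hHat hN.kahler hK x
    have h3 := StatGeom.norm_traceField_sq_inducedTensor hf hN.kahler hK x
    rw [hfin] at h1 h2 h3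
    have h4 := StatGeom.neg_mul_le_sub_of_three_mul_le h2
    have h5 := StatGeom.neg_div_mul_le_sub_of_three_mul_le hn h2
    refine ⟨?_, by linarith⟩
    rw [h3] at h1 h5
    -- Splitting off $cn(n-1)$ leaves $\frac{n-1}{n+2}\|E\|^2$ with $\|E\|^2=n^2\|\mu\|^2$, which is
    -- linear in the quantities of `h1` and `h5`.
    have h6 : (n : ℝ) * ((n : ℝ) - 1) / ((n : ℝ) + 2) * (c * ((n : ℝ) + 2)
        + (n : ℝ) * ‖StatGeom.meanCurvature (𝓡 n) nablaN f x‖ ^ 2) = c * (n * (n - 1))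
        + ((n : ℝ) - 1) / ((n : ℝ) + 2)
          * ((n : ℝ) ^ 2 * ‖StatGeom.meanCurvature (𝓡 n) nablaN f x‖ ^ 2) := by
      field_simp
    rw [h6]
    linarith
  · have hR := h.curvature_eq_of_sphere (hS x)
    obtain ⟨h1, h2⟩ := h.scalarCurvature_sub hHat x
    rw [StatGeom.scalarCurvature_of_curvature_eq hR] at h1
    rw [hfin] at h1 h2
    have h4 := StatGeom.neg_mul_le_sub_of_three_mul_le h2
    have h5 := StatGeom.neg_div_mul_le_sub_of_three_mul_le hn h2
    refine ⟨hR, ?_, by linarith⟩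
    have h6 : ((n : ℝ) - 1) / ((n : ℝ) + 2) * (H x * (n : ℝ) * ((n : ℝ) + 2)
        - ‖StatGeom.traceField (StatGeom.differenceTensor nabla nablaHat) x‖ ^ 2) =
        H x * (n * (n - 1)) - ((n : ℝ) - 1) / ((n : ℝ) + 2)
          * ‖StatGeom.traceField (StatGeom.differenceTensor nabla nablaHat) x‖ ^ 2 := by
      field_simp
    rw [h6]
    linarith
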